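/- Let $G$ be a finite simple graph with vertex set $V(G)$, let $\pi=\{W_1,\dots,W_r\}$ be a clique partition of $G$ (each $W_i$ is a clique of $G$ and $V(G)$ is the disjoint union of the $W_i$), and let $\Bbbk$ be an arbitrary field. The clique-whiskered graph $G^{\pi}$ is obtained from $G$ by adding new vertices $w_1,\dots,w_r$ and the edges $\{x,w_i\}$ for all $i$ and all $x\in W_i$. For positive integers $n_1,\dots,n_r$, the multi-clique-whiskered graph $G^{\pi}[n_1,\dots,n_r]$ is obtained from $G$ by adding new vertices $w_{i,k}$ ($1\le i\le r$, $1\le k\le n_i$) and the edges $\{x,w_{i,k}\}$ for all $i,k$ and all $x\in W_i$. For a finite graph $H$, let $\mathrm{Min}(H)$ be the set of its inclusion-minimal vertex covers, and let the cover ideal $J(H)\subseteq S=\Bbbk[V(H)]$ be the ideal generated by the monomials $\prod_{x\in C}x$, where $C$ runs over the vertex covers of $H$. Let $\beta_{i,j}(J(H))$ be its graded Betti numbers, i.e. the exponent of $S(-j)$ in homological degree $i$ of a graded minimal free resolution of $J(H)$, let $\beta_i(J(H))=\sum_j\beta_{i,j}(J(H))$, and $\mathrm{pd}(J(H))=\max\{i:\beta_{i,j}(J(H))\neq0\text{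 for some }j\}$. Graded minimal free resolutions of the ideals below exist and have uniquely determined ranks in each homological and internal degree, so that these numbers are well defined, and the maximum defining $\mathrm{pd}$ exists. (A) Let $H=G^{\pi}[n_1,\dots,n_r]$. Then, for all $i\ge0$ and all $j$, $$\beta_{i,i+j}(J(H))=\sum_{\substack{C\in\mathrm{Min}(H)\\ |C|=j}}\binom{|V(G)\setminus C|}{i},$$ and $\mathrm{pd}(J(H))=\max\{|V(G)\setminus C| : C\in\mathrm{Min}(H)\}$. The graded Betti numbers of $J(H)$ do not depend on the field $\Bbbk$; in particular, they do not depend on its characteristic. (B) Let $H=G^{\pi}$. Then $J(H)$ has a linear resolution, namely $\beta_{i,j}(J(H))=0$ unless $j=i+|V(G)|$; for all $i\ge0$, $$\beta_{i,i+|V(G)|}(J(H))=\beta_i(J(H))=\sum_{C\in\mathrm{Min}(H)}\binom{|V(G)\setminus C|}{i},$$ and $\mathrm{pd}(J(H))=\max\{|V(G)\setminus C| : C\in\mathrm{Min}(H)\}$. The graded Betti numbers of $J(H)$ do not depend on the field $\Bbbk$; in particular, they do not depend on its characteristic. -/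

import Mathlib

open scoped Finset

universe u v

/-! ## Graphs -/

section Graphs

variable {V : Type u} {r : ℕ}

/-- The family `W 0, …, W (r - 1)` is a clique partition of `G`: every `W i` is a clique of `G`, and
the vertex set is the disjoint union of the `W i`. -/
structure IsCliquePartition (G : SimpleGraph V) (W : Fin r → Finset V) : Prop where
  isClique : ∀ i, G.IsClique (W i : Set V)
  disjoint : Pairwise fun i j => Disjoint (W i) (W j)
  cover : ∀ x, ∃ i, x ∈ W i

/-- The clique-whiskered graph: the vertices are the old vertices `inl x` and one new vertex
`inr i` for each block; the edges are those of `G` together with `{x, inr i}` for `x ∈ W i`. -/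
def cliqueWhiskered (G : SimpleGraph V) (W : Fin r → Finset V) : SimpleGraph (V ⊕ Fin r) where
  Adj
    | .inl x, .inl y => G.Adj x y
    | .inl x, .inr i => x ∈ W i
    | .inr i, .inl x => x ∈ W i
    | .inr _, .inr _ => False
  symm := ⟨by
    rintro (x | i) (y | j) h
    · exact G.adj_symm h
    · exact h
    · exact h
    · exact h⟩
  loopless := ⟨by
    rintro (x | i) h
    · exact G.loopless.irrefl x h
    · exact h⟩

/-- The multi-clique-whiskered graph: the vertices are the old vertices `inl x` and, for each block
`i`, the `n i` new vertices `inr ⟨i, k⟩`; the edges are those of `G` together with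
`{x, inr ⟨i, k⟩}` for `x ∈ W i`. -/
def multiCliqueWhiskered (G : SimpleGraph V) (W : Fin r → Finset V) (n : Fin r → ℕ) :
    SimpleGraph (V ⊕ (Σ i : Fin r, Fin (n i))) where
  Adj
    | .inl x, .inl y => G.Adj x y
    | .inl x, .inr w => x ∈ W w.1
    | .inr w, .inl x => x ∈ W w.1
    | .inr _, .inr _ => False
  symm := ⟨by
    rintro (x | i) (y | j) h
    · exact G.adj_symm h
    · exact h
    · exact h
    · exact h⟩
  loopless := ⟨by
    rintro (x | i) h
    · exact G.loopless.irrefl x h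
    · exact h⟩

open Classical in
/-- The finite set of inclusion-minimal vertex covers of a finite graph. -/
noncomputable def minVertexCovers [Fintype V] (G : SimpleGraph V) : Finset (Finset V) :=
  {C | Minimal (fun D : Finset V => G.IsVertexCover (D : Set V)) C}

open Classical in
/-- `V ∖ C`, the set of those old vertices (elements of `V`) that do not lie in the set `C` of
vertices of a graph on `V ⊕ Y`. -/
noncomputable def oldVerticesOutside [Fintype V] {Y : Type*} (C : Finset (V ⊕ Y)) : Finset V :=
  {x | Sum.inl x ∉ C}

/-- The cover ideal of `G`, generated by the squarefree monomials of the vertex covers of `G`. -/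
noncomputable def coverIdeal (K : Type v) [Field K] (G : SimpleGraph V) :
    Ideal (MvPolynomial V K) :=
  Ideal.span {p | ∃ C : Finset V, G.IsVertexCover (C : Set V) ∧ p = ∏ x ∈ C, MvPolynomial.X x}

end Graphs

/-! ## Graded minimal free resolutions and Betti numbers of homogeneous ideals -/

section Resolutions

variable {σ : Type u} {K : Type v} [Field K]

/-- `p` is homogeneous of (integer) degree `d` in the standard grading. -/
def HomogeneousOfDegree (p : MvPolynomial σ K) (d : ℤ) : Prop :=
  ∀ m ∈ p.support, (m.degree : ℤ) = d

/-- A graded free resolution `⋯ → F₁ → F₀ → I → 0` of the ideal `I` of the polynomial ring `S` by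
free modules of finite rank. Here `F i` is free with basis `gen i`, and the basis element `e` has
degree `deg i e`, that is, `F i` is the direct sum of the `S(-deg i e)`. -/
structure GradedFreeResolution (I : Ideal (MvPolynomial σ K)) where
  gen : ℕ → Type u
  finite_gen : ∀ i, Finite (gen i)
  deg : ∀ i, gen i → ℤ
  /-- The augmentation `F₀ → I ⊆ S`. -/
  aug : (gen 0 →₀ MvPolynomial σ K) →ₗ[MvPolynomial σ K] MvPolynomial σ K
  /-- The differential `F (i + 1) → F i`. -/
  d : ∀ i, (gen (i + 1) →₀ MvPolynomial σ K) →ₗ[MvPolynomial σ K] (gen i →₀ MvPolynomial σ K)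
  aug_homogeneous : ∀ e : gen 0, HomogeneousOfDegree (aug (Finsupp.single e 1)) (deg 0 e)
  d_homogeneous : ∀ i (e : gen (i + 1)) (f : gen i),
    HomogeneousOfDegree (d i (Finsupp.single e 1) f) (deg (i + 1) e - deg i f)
  range_aug : LinearMap.range aug = I
  exact_zero : Function.Exact (d 0) aug
  exact_succ : ∀ i, Function.Exact (d (i + 1)) (d i)

namespace GradedFreeResolution

variable {I : Ideal (MvPolynomial σ K)}

/-- The resolution is minimal: every differential maps `F (i + 1)` into `𝔪 F i`, where `𝔪` is the
ideal generated by the variables. -/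
def IsMinimal (F : GradedFreeResolution I) : Prop :=
  ∀ i x (f : F.gen i),
    F.d i x f ∈ Ideal.span (Set.range (MvPolynomial.X : σ → MvPolynomial σ K))

/-- The number of basis elements of degree `j` of `F i`, that is, the exponent of `S(-j)`. -/
noncomputable def rank (F : GradedFreeResolution I) (i : ℕ) (j : ℤ) : ℕ :=
  Nat.card {e : F.gen i // F.deg i e = j}

end GradedFreeResolution

open Classical in
/-- The graded Betti number `β_{i,j}(I)`: the exponent of `S(-j)` in homological degree `i` of a
graded minimal free resolution of `I` (and `0` if `I` has none). -/
noncomputable def gradedBetti (I : Ideal (MvPolynomial σ K)) (i : ℕ) (j : ℤ) : ℕ :=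
  if h : ∃ F : GradedFreeResolution I, F.IsMinimal then h.choose.rank i j else 0

/-- The total Betti number `β_i(I) = ∑_j β_{i,j}(I)`. -/
noncomputable def totalBetti (I : Ideal (MvPolynomial σ K)) (i : ℕ) : ℕ :=
  ∑ᶠ j : ℤ, gradedBetti I i j

/-- The projective dimension `max {i : β_{i,j}(I) ≠ 0 for some j}`. -/
noncomputable def projDim (I : Ideal (MvPolynomial σ K)) : ℕ :=
  sSup {i | ∃ j : ℤ, gradedBetti I i j ≠ 0}

/-- The graded Betti numbers of `I` are well defined and its projective dimension is a maximum:
`I` has a graded minimal free resolution, all of these have the same ranks in each homological and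
internal degree, and the set of `i` with some `β_{i,j}(I) ≠ 0` has a greatest element. -/
def BettiWellDefined (I : Ideal (MvPolynomial σ K)) : Prop :=
  (∃ F : GradedFreeResolution I, F.IsMinimal) ∧
  (∀ F : GradedFreeResolution I, F.IsMinimal → ∀ i j, F.rank i j = gradedBetti I i j) ∧
  IsGreatest {i | ∃ j : ℤ, gradedBetti I i j ≠ 0} (projDim I)

/-- `I` has a `c`-linear resolution: `β_{i,j}(I) = 0` unless `j = i + c`. -/
def HasLinearResolution (I : Ideal (MvPolynomial σ K)) (c : ℕ) : Prop :=
  ∀ (i : ℕ) (j : ℤ), gradedBetti I i j ≠ 0 → j = i + c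

end Resolutions

/-! For an independent set `A` of `G`, the complement of `A` together with the new vertices adjacent
to `A` is a vertex cover. Every minimal cover has this form: cliques and whiskers make such a cover
irredundant, and every cover contains the one given by the old vertices it omits. Hence `J(H)` is
generated by the monomials `m_A = ∏_{x ∉ A} X x * ∏_{x ∈ A} Y x`, where `A` runs over the
independence complex `Δ` and `Y x` is the product of the new variables adjacent to `x`.

Such an ideal has an explicit cubical resolution. Its basis consists of the pairs `B ⊆ A ∈ Δ`, in
homological degree `#B`, and the differential sends `e (A, B)` to the signed sum over `x ∈ B` of `X
x • e (A, B \ x) - Y x • e (A \ x, B \ x)`. Exactness (`exists_cubeD_eq`) is proved by removing the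
facets of `Δ` one at a time: on a facet `A` one sees the Koszul complex of the variables `X x`, `x ∈
A`, which is acyclic (`exists_koszulD_eq`). No matrix entry has a constant term, so the resolution
is minimal. Each `A` contributes `(#A).choose i` basis elements in degree `deg m_A + i`, over every
field.

Minimal resolutions of the same ideal have equal ranks (`exists_comparison`,
`IsHomogeneousMap.card_le`), so these counts are the Betti numbers. -/

/-! ### Homogeneous polynomials and components of integer degree. -/

section HomogeneousPolynomials

variable {σ : Type u} {K : Type v} [Field K]

theorem HomogeneousOfDegree.sum {ι : Type*} (s : Finset ι) (f : ι → MvPolynomial σ K) {d : ℤ}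
    (h : ∀ i ∈ s, HomogeneousOfDegree (f i) d) : HomogeneousOfDegree (∑ i ∈ s, f i) d := by
  classical
  intro m hm
  obtain ⟨i, hi, hmi⟩ := Finset.mem_biUnion.1 (MvPolynomial.support_sum hm)
  exact h i hi m hmi

theorem HomogeneousOfDegree.mul {p q : MvPolynomial σ K} {a b : ℤ} (hp : HomogeneousOfDegree p a)
    (hq : HomogeneousOfDegree q b) : HomogeneousOfDegree (p * q) (a + b) := by
  classical
  intro m hm
  obtain ⟨x, hx, y, hy, rfl⟩ := Finset.mem_add.1 (MvPolynomial.support_mul p q hm)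
  rw [map_add, Nat.cast_add, hp x hx, hq y hy]

theorem HomogeneousOfDegree.neg {p : MvPolynomial σ K} {a : ℤ} (hp : HomogeneousOfDegree p a) :
    HomogeneousOfDegree (-p) a := by
  intro m hm
  rw [MvPolynomial.support_neg] at hm
  exact hp m hm

theorem HomogeneousOfDegree.constantCoeff_eq_zero {p : MvPolynomial σ K} {a : ℤ}
    (hp : HomogeneousOfDegree p a) (ha : a ≠ 0) : MvPolynomial.constantCoeff p = 0 := by
  by_contra h
  have := hp 0 (by simpa [MvPolynomial.mem_support_iff, MvPolynomial.constantCoeff_eq] using h)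
  simp at this
  exact ha this.symm

open Classical in
/-- The homogeneous component of integer degree `d`. -/
noncomputable def intComponent (d : ℤ) (p : MvPolynomial σ K) : MvPolynomial σ K :=
  ∑ m ∈ p.support with (m.degree : ℤ) = d, MvPolynomial.monomial m (p.coeff m)

open Classical in
theorem coeff_intComponent (d : ℤ) (p : MvPolynomial σ K) (n : σ →₀ ℕ) :
    (intComponent d p).coeff n = if (n.degree : ℤ) = d then p.coeff n else 0 := by
  simp only [intComponent, MvPolynomial.coeff_sum, MvPolynomial.coeff_monomial,
    Finset.sum_ite_eq', Finset.mem_filter, MvPolynomial.mem_support_iff]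
  grind

theorem homogeneousOfDegree_intComponent (d : ℤ) (p : MvPolynomial σ K) :
    HomogeneousOfDegree (intComponent d p) d := by
  classical
  intro m hm
  rw [MvPolynomial.mem_support_iff, coeff_intComponent] at hm
  by_contra h
  simp [h] at hm

theorem HomogeneousOfDegree.intComponent_eq {p : MvPolynomial σ K} {d : ℤ}
    (hp : HomogeneousOfDegree p d) : intComponent d p = p := by
  classical
  ext n
  rw [coeff_intComponent]
  split_ifs with h
  · rfl
  · by_contra h'
    exact h (hp n (MvPolynomial.mem_support_iff.2 (Ne.symm h')))

theorem intComponent_sum {ι : Type*} (s : Finset ι) (f : ι → MvPolynomial σ K) (d : ℤ) :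
    intComponent d (∑ i ∈ s, f i) = ∑ i ∈ s, intComponent d (f i) := by
  classical
  ext n
  simp only [coeff_intComponent, MvPolynomial.coeff_sum]
  split_ifs <;> simp

/-- Every monomial of `q` has degree `b`, so only the monomials of `p` of degree `a` can contribute
in degree `a + b`. -/
theorem intComponent_mul {q : MvPolynomial σ K} {b : ℤ} (hq : HomogeneousOfDegree q b)
    (a : ℤ) (p : MvPolynomial σ K) :
    intComponent (a + b) (p * q) = intComponent a p * q := by
  classical
  ext n
  rw [coeff_intComponent, MvPolynomial.coeff_mul, MvPolynomial.coeff_mul]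
  simp only [coeff_intComponent]
  have key : ∀ x ∈ Finset.HasAntidiagonal.antidiagonal n, ((n.degree : ℤ) = a + b ↔ (x.1.degree : ℤ) = a) ∨
      q.coeff x.2 = 0 := by
    rintro ⟨x, y⟩ hxy
    rw [Finset.HasAntidiagonal.mem_antidiagonal] at hxy
    by_cases h : q.coeff y = 0
    · exact Or.inr h
    · left
      have := hq y (MvPolynomial.mem_support_iff.2 h)
      have h2 : n.degree = x.degree + y.degree := by rw [← hxy]; simp
      constructor <;> intro <;> simp only at * <;> omega
  split_ifs with h
  · refine Finset.sum_congr rfl fun x hx => ?_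
    rcases key x hx with h1 | h1
    · rw [if_pos (h1.1 h)]
    · simp [h1]
  · symm
    refine Finset.sum_eq_zero fun x hx => ?_
    rcases key x hx with h1 | h1
    · rw [if_neg (fun h2 => h (h1.2 h2)), zero_mul]
    · simp [h1]

end HomogeneousPolynomials

/-! ### Degree-preserving maps of graded free modules. -/

section HomogeneousMaps

variable {σ : Type u} {K : Type v} [Field K] {α β γ : Type*}

/-- A map of graded free modules of degree `0`, in terms of its matrix entries. -/
def IsHomogeneousMap (dα : α → ℤ) (dβ : β → ℤ)
    (L : (α →₀ MvPolynomial σ K) →ₗ[MvPolynomial σ K] (β →₀ MvPolynomial σ K)) : Prop :=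
  ∀ e f, HomogeneousOfDegree (L (Finsupp.single e 1) f) (dα e - dβ f)

theorem linearMap_finsupp_apply [Fintype α] {R : Type*} [CommRing R]
    (L : (α →₀ R) →ₗ[R] (β →₀ R)) (x : α →₀ R) (g : β) :
    L x g = ∑ f, x f * L (Finsupp.single f 1) g := by
  conv_lhs => rw [← Finsupp.univ_sum_single x]
  simp only [map_sum, Finsupp.finsetSum_apply]
  refine Finset.sum_congr rfl fun f _ => ?_
  rw [← mul_one (x f), ← smul_eq_mul, ← Finsupp.smul_single, map_smul]
  simp

theorem IsHomogeneousMap.comp [Finite β] {dα : α → ℤ} {dβ : β → ℤ} {dγ : γ → ℤ}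
    {L : (α →₀ MvPolynomial σ K) →ₗ[MvPolynomial σ K] (β →₀ MvPolynomial σ K)}
    {M : (β →₀ MvPolynomial σ K) →ₗ[MvPolynomial σ K] (γ →₀ MvPolynomial σ K)}
    (hM : IsHomogeneousMap dβ dγ M) (hL : IsHomogeneousMap dα dβ L) :
    IsHomogeneousMap dα dγ (M ∘ₗ L) := by
  have := Fintype.ofFinite β
  intro e g
  rw [LinearMap.comp_apply, linearMap_finsupp_apply]
  refine HomogeneousOfDegree.sum _ _ fun f _ => ?_
  have := (hL e f).mul (hM f g)
  simpa using this

/-- Lift basis elements arbitrarily, then cut every entry down to the degree it should have; since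
`M` and `L` are homogeneous, the discarded components do not matter. -/
theorem IsHomogeneousMap.exists_lift [Finite β] {dα : α → ℤ} {dβ : β → ℤ} {dγ : γ → ℤ}
    {L : (α →₀ MvPolynomial σ K) →ₗ[MvPolynomial σ K] (γ →₀ MvPolynomial σ K)}
    {M : (β →₀ MvPolynomial σ K) →ₗ[MvPolynomial σ K] (γ →₀ MvPolynomial σ K)}
    (hL : IsHomogeneousMap dα dγ L) (hM : IsHomogeneousMap dβ dγ M)
    (hLM : ∀ x, L x ∈ LinearMap.range M) :
    ∃ φ : (α →₀ MvPolynomial σ K) →ₗ[MvPolynomial σ K] (β →₀ MvPolynomial σ K),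
      IsHomogeneousMap dα dβ φ ∧ M ∘ₗ φ = L := by
  have := Fintype.ofFinite β
  choose w hw using fun e : α => hLM (Finsupp.single e 1)
  refine ⟨Finsupp.linearCombination _ fun e => Finsupp.equivFunOnFinite.symm fun f =>
    intComponent (dα e - dβ f) (w e f), fun e f => ?_, ?_⟩
  · simpa using homogeneousOfDegree_intComponent _ _
  · refine Finsupp.lhom_ext' fun e => LinearMap.ext_ring (Finsupp.ext fun g => ?_)
    simp only [LinearMap.comp_apply, Finsupp.lsingle_apply, Finsupp.linearCombination_single,
      one_smul]
    rw [linearMap_finsupp_apply, ← (hL e g).intComponent_eq, ← hw e,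
      linearMap_finsupp_apply M (w e), intComponent_sum]
    refine Finset.sum_congr rfl fun f _ => ?_
    have := intComponent_mul (hM f g) (dα e - dβ f) (w e f)
    rw [sub_add_sub_cancel] at this
    rw [this]
    rfl

/-- The ungraded lift is used for homotopies, whose degrees play no role. -/
theorem exists_linear_lift {R M N : Type*} [CommRing R] [AddCommGroup M] [AddCommGroup N]
    [Module R M] [Module R N] (L : (α →₀ R) →ₗ[R] N) (P : M →ₗ[R] N)
    (h : ∀ x, L x ∈ LinearMap.range P) : ∃ φ : (α →₀ R) →ₗ[R] M, P ∘ₗ φ = L := by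
  choose w hw using fun e : α => h (Finsupp.single e 1)
  refine ⟨Finsupp.linearCombination _ w, Finsupp.lhom_ext' fun e => LinearMap.ext_ring ?_⟩
  simp [hw]

/-- If the composite of two homogeneous maps is the identity up to entries without constant term,
then the number of basis elements in each degree cannot decrease. -/
theorem IsHomogeneousMap.card_le [Finite α] [Finite β] {dα : α → ℤ} {dβ : β → ℤ}
    {φ : (α →₀ MvPolynomial σ K) →ₗ[MvPolynomial σ K] (β →₀ MvPolynomial σ K)}
    {ψ : (β →₀ MvPolynomial σ K) →ₗ[MvPolynomial σ K] (α →₀ MvPolynomial σ K)}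
    (hφ : IsHomogeneousMap dα dβ φ)
    (h : ∀ x f, MvPolynomial.constantCoeff ((ψ (φ x) - x) f) = 0) (j : ℤ) :
    Nat.card {e // dα e = j} ≤ Nat.card {e // dβ e = j} := by
  classical
  have := Fintype.ofFinite α
  have := Fintype.ofFinite β
  rw [Nat.card_eq_fintype_card, Nat.card_eq_fintype_card]
  let A : Matrix {e // dα e = j} {e // dβ e = j} K :=
    fun e f => MvPolynomial.constantCoeff (φ (Finsupp.single e.1 1) f.1)
  let B : Matrix {e // dβ e = j} {e // dα e = j} K :=
    fun f e => MvPolynomial.constantCoeff (ψ (Finsupp.single f.1 1) e.1)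
  have hAB : A * B = 1 := by
    ext e e'
    have h1 := h (Finsupp.single e.1 1) e'.1
    rw [Finsupp.sub_apply, map_sub, linearMap_finsupp_apply ψ, map_sum, sub_eq_zero] at h1
    rw [Matrix.mul_apply]
    trans ∑ f, MvPolynomial.constantCoeff (φ (Finsupp.single e.1 1) f *
      ψ (Finsupp.single f 1) e'.1)
    -- Entries of `φ` from degree `j` into another degree have no constant term, so only the `f` of
    -- degree `j` survive.
    · rw [← Finset.sum_subset (Finset.subset_univ (Finset.univ.filter fun f => dβ f = j)),
        Finset.sum_subtype (Finset.univ.filter fun f => dβ f = j) (p := fun f => dβ f = j)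
          (F := inferInstance)
          (by simp)]
      · simp [A, B]
      · intro f _ hf
        rw [map_mul, (hφ e.1 f).constantCoeff_eq_zero, zero_mul]
        rw [e.2]
        simp at hf
        omega
    · rw [h1, Matrix.one_apply, Finsupp.single_apply]
      by_cases hee : e = e'
      · simp [hee]
      · rw [if_neg hee, if_neg (fun h => hee (Subtype.ext h)), map_zero]
  calc Fintype.card {e // dα e = j} = (1 : Matrix {e // dα e = j} {e // dα e = j} K).rank := by
        rw [Matrix.rank_one]
    _ ≤ A.rank := by rw [← hAB]; exact Matrix.rank_mul_le_left A B
    _ ≤ _ := A.rank_le_card_width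

end HomogeneousMaps

/-! ### Uniqueness of the ranks of minimal resolutions. -/

namespace GradedFreeResolution

variable {σ : Type u} {K : Type v} [Field K] {I : Ideal (MvPolynomial σ K)}

theorem IsMinimal.constantCoeff_d {F : GradedFreeResolution I} (hF : F.IsMinimal) (i : ℕ)
    (x : F.gen (i + 1) →₀ MvPolynomial σ K) (f : F.gen i) :
    MvPolynomial.constantCoeff (F.d i x f) = 0 := by
  have h : Ideal.span (Set.range (MvPolynomial.X : σ → MvPolynomial σ K)) ≤
      RingHom.ker (MvPolynomial.constantCoeff : MvPolynomial σ K →+* K) := by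
    rw [Ideal.span_le]
    rintro _ ⟨x, rfl⟩
    simp
  exact h (hF i x f)

/-- The augmentation as a map between free modules. -/
noncomputable def augFinsupp (F : GradedFreeResolution I) :
    (F.gen 0 →₀ MvPolynomial σ K) →ₗ[MvPolynomial σ K] (Unit →₀ MvPolynomial σ K) :=
  Finsupp.lsingle () ∘ₗ F.aug

theorem isHomogeneousMap_augFinsupp (F : GradedFreeResolution I) :
    IsHomogeneousMap (F.deg 0) (fun _ => 0) F.augFinsupp := by
  intro e f
  simpa [augFinsupp] using F.aug_homogeneous e

theorem augFinsupp_eq_iff (F F' : GradedFreeResolution I) (x : F.gen 0 →₀ MvPolynomial σ K)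
    (y : F'.gen 0 →₀ MvPolynomial σ K) :
    F.augFinsupp x = F'.augFinsupp y ↔ F.aug x = F'.aug y := by
  simp [augFinsupp]

theorem exists_aug_lift (F F' : GradedFreeResolution I) :
    ∃ φ : (F.gen 0 →₀ MvPolynomial σ K) →ₗ[MvPolynomial σ K] (F'.gen 0 →₀ MvPolynomial σ K),
      IsHomogeneousMap (F.deg 0) (F'.deg 0) φ ∧ ∀ x, F'.aug (φ x) = F.aug x := by
  have := F'.finite_gen 0
  obtain ⟨φ, hφ, h⟩ := F.isHomogeneousMap_augFinsupp.exists_lift F'.isHomogeneousMap_augFinsupp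
    (fun x => by
      have hx : F.aug x ∈ LinearMap.range F'.aug := F'.range_aug.ge (F.range_aug.le ⟨x, rfl⟩)
      obtain ⟨y, hy⟩ := hx
      exact ⟨y, (augFinsupp_eq_iff F' F y x).2 hy⟩)
  exact ⟨φ, hφ, fun x => (augFinsupp_eq_iff F' F _ _).1 (LinearMap.congr_fun h x)⟩

/-- Comparison of a minimal resolution with another one: in each homological degree there are
homogeneous maps in both directions which preserve boundaries and whose composite is homotopic to
the identity; by minimality this composite is the identity up to entries without constant term. -/
theorem exists_comparison (F F' : GradedFreeResolution I) (hF : F.IsMinimal) (i : ℕ) :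
    ∃ (φ : (F.gen i →₀ MvPolynomial σ K) →ₗ[MvPolynomial σ K] (F'.gen i →₀ MvPolynomial σ K))
      (ψ : (F'.gen i →₀ MvPolynomial σ K) →ₗ[MvPolynomial σ K] (F.gen i →₀ MvPolynomial σ K))
      (h : (F.gen i →₀ MvPolynomial σ K) →ₗ[MvPolynomial σ K]
        (F.gen (i + 1) →₀ MvPolynomial σ K)),
      IsHomogeneousMap (F.deg i) (F'.deg i) φ ∧ IsHomogeneousMap (F'.deg i) (F.deg i) ψ ∧
      (∀ z, φ (F.d i z) ∈ LinearMap.range (F'.d i)) ∧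
      (∀ z, ψ (F'.d i z) ∈ LinearMap.range (F.d i)) ∧
      (∀ z, ψ (φ (F.d i z)) - F.d i z = F.d i (h (F.d i z))) ∧
      ∀ x f, MvPolynomial.constantCoeff ((ψ (φ x) - x) f) = 0 := by
  induction i with
  | zero =>
    obtain ⟨φ, hφ, hφa⟩ := exists_aug_lift F F'
    obtain ⟨ψ, hψ, hψa⟩ := exists_aug_lift F' F
    obtain ⟨h, hh⟩ := exists_linear_lift (ψ ∘ₗ φ - LinearMap.id) (F.d 0) (fun x => by
      refine (F.exact_zero _).1 ?_
      simp [hφa, hψa])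
    replace hh : ∀ x, ψ (φ x) - x = F.d 0 (h x) := fun x => (LinearMap.congr_fun hh x).symm
    refine ⟨φ, ψ, h, hφ, hψ, fun z => (F'.exact_zero _).1 ?_, fun z => (F.exact_zero _).1 ?_,
      fun z => hh _, fun x f => ?_⟩
    · rw [hφa]
      exact (F.exact_zero _).2 ⟨z, rfl⟩
    · rw [hψa]
      exact (F'.exact_zero _).2 ⟨z, rfl⟩
    · rw [hh]
      exact hF.constantCoeff_d _ _ _
  | succ i ih =>
    obtain ⟨φ, ψ, h, hφ, hψ, hφd, hψd, hh, -⟩ := ih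
    have := F.finite_gen i
    have := F'.finite_gen i
    have := F.finite_gen (i + 1)
    have := F'.finite_gen (i + 1)
    obtain ⟨φ', hφ', hφφ'⟩ := (hφ.comp (F.d_homogeneous i)).exists_lift (F'.d_homogeneous i) hφd
    obtain ⟨ψ', hψ', hψψ'⟩ := (hψ.comp (F'.d_homogeneous i)).exists_lift (F.d_homogeneous i) hψd
    replace hφφ' : ∀ x, F'.d i (φ' x) = φ (F.d i x) := LinearMap.congr_fun hφφ'
    replace hψψ' : ∀ x, F.d i (ψ' x) = ψ (F'.d i x) := LinearMap.congr_fun hψψ'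
    -- The previous homotopy identity, known on boundaries, says that this map takes values in
    -- cycles; exactness then yields the next homotopy.
    obtain ⟨h', hh'⟩ := exists_linear_lift (ψ' ∘ₗ φ' - LinearMap.id - h ∘ₗ F.d i) (F.d (i + 1))
      (fun x => by
        refine (F.exact_succ i _).1 ?_
        simp [hφφ', hψψ', ← hh])
    replace hh' : ∀ x, ψ' (φ' x) - x = h (F.d i x) + F.d (i + 1) (h' x) := fun x => by
      rw [← sub_eq_iff_eq_add']
      exact (LinearMap.congr_fun hh' x).symm
    have hd : ∀ z, F.d i (F.d (i + 1) z) = 0 := fun z => (F.exact_succ i _).2 ⟨z, rfl⟩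
    have hd' : ∀ z, F'.d i (F'.d (i + 1) z) = 0 := fun z => (F'.exact_succ i _).2 ⟨z, rfl⟩
    refine ⟨φ', ψ', h', hφ', hψ', fun z => (F'.exact_succ i _).1 ?_,
      fun z => (F.exact_succ i _).1 ?_, fun z => ?_, fun x f => ?_⟩
    · rw [hφφ', hd, map_zero]
    · rw [hψψ', hd', map_zero]
    · rw [hh', hd, map_zero, zero_add]
    · have := Fintype.ofFinite (F.gen i)
      -- The homotopy need not be minimal, but it is applied to `F.d i x`, whose coordinates already
      -- have no constant term.
      rw [hh', Finsupp.add_apply, map_add, hF.constantCoeff_d, add_zero,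
        linearMap_finsupp_apply h, map_sum]
      exact Finset.sum_eq_zero fun g _ => by rw [map_mul, hF.constantCoeff_d, zero_mul]

theorem IsMinimal.rank_eq {F F' : GradedFreeResolution I} (hF : F.IsMinimal) (hF' : F'.IsMinimal)
    (i : ℕ) (j : ℤ) : F.rank i j = F'.rank i j := by
  have := F.finite_gen i
  have := F'.finite_gen i
  obtain ⟨φ, ψ, -, hφ, -, -, -, -, h⟩ := exists_comparison F F' hF i
  obtain ⟨φ', ψ', -, hφ', -, -, -, -, h'⟩ := exists_comparison F' F hF' i
  exact le_antisymm (hφ.card_le h j) (hφ'.card_le h' j)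

theorem IsMinimal.gradedBetti_eq {F : GradedFreeResolution I} (hF : F.IsMinimal) (i : ℕ) (j : ℤ) :
    gradedBetti I i j = F.rank i j := by
  have h : ∃ F : GradedFreeResolution I, F.IsMinimal := ⟨F, hF⟩
  rw [gradedBetti, dif_pos h]
  exact h.choose_spec.rank_eq hF i j

end GradedFreeResolution

/-! ### The Koszul complex and the cubical complex, with all dimensions taken together. -/

section Cubes

variable {V : Type*} {R : Type*} [CommRing R]

/-- `f` is supported on the cubes `(A, B)` with `A ∈ Δ`. -/
def CubeSupported (Δ : Finset (Finset V)) (f : Finset V × Finset V → R) : Prop :=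
  ∀ p, f p ≠ 0 → p.2 ⊆ p.1 ∧ p.1 ∈ Δ

variable [DecidableEq V]

/-- The sign of `x` relative to `B` for the order on the vertices given by `o`. -/
def cubeSign (R : Type*) [CommRing R] (o : V → ℕ) (x : V) (B : Finset V) : R :=
  (-1) ^ #{y ∈ B | o y < o x}

theorem cubeSign_insert_of_lt {o : V → ℕ} {x z : V} {B : Finset V} (hz : z ∉ B)
    (h : o z < o x) : cubeSign R o x (insert z B) = -cubeSign R o x B := by
  rw [cubeSign, cubeSign, Finset.filter_insert, if_pos h, Finset.card_insert_of_notMem (by simp [hz]),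
    pow_succ, mul_neg_one]

theorem cubeSign_insert_of_not_lt {o : V → ℕ} {x z : V} {B : Finset V}
    (h : ¬ o z < o x) : cubeSign R o x (insert z B) = cubeSign R o x B := by
  rw [cubeSign, cubeSign, Finset.filter_insert, if_neg h]

/-- Exactly one of `x`, `z` precedes the other, so exactly one of the two signs flips. -/
theorem cubeSign_mul_comm {o : V → ℕ} (ho : Function.Injective o) {x z : V} {B : Finset V}
    (hx : x ∉ B) (hz : z ∉ B) (hxz : x ≠ z) :
    cubeSign R o x B * cubeSign R o z (insert x B) +
      cubeSign R o z B * cubeSign R o x (insert z B) = 0 := by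
  rcases lt_or_gt_of_ne (ho.ne hxz) with h | h
  · rw [cubeSign_insert_of_lt hx h, cubeSign_insert_of_not_lt h.not_gt]
    ring
  · rw [cubeSign_insert_of_lt hz h, cubeSign_insert_of_not_lt h.not_gt]
    ring

variable [Fintype V]

/-- The Koszul differential on the variables `X`; a function `g` stands for `∑ B, g B • e B`. -/
def koszulD (o : V → ℕ) (X : V → R) (g : Finset V → R) (B : Finset V) : R :=
  ∑ x ∈ Bᶜ, cubeSign R o x B * X x * g (insert x B)

theorem koszulD_eq_zero {o : V → ℕ} {X : V → R} {g : Finset V → R} {A : Finset V}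
    (hg : ∀ B, ¬ B ⊆ A → g B = 0) {B : Finset V} (hB : ¬ B ⊆ A) : koszulD o X g B = 0 :=
  Finset.sum_eq_zero fun x _ => by
    rw [hg _ fun h => hB ((Finset.subset_insert x B).trans h), mul_zero]

/-- The Koszul complex on `insert a A` is the mapping cone of multiplication by `X a` on the one for
`A`. As `a` comes last, it leaves the other signs alone and its own sign is `(-1) ^ #B`. -/
theorem koszulD_glue {o : V → ℕ} {X : V → R} {h₀ h₁ : Finset V → R} {A : Finset V} {a : V}
    (ha : a ∉ A) (hmax : ∀ x ∈ A, o x < o a) (hh₀ : ∀ B, ¬ B ⊆ A → h₀ B = 0)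
    (hh₁ : ∀ B, ¬ B ⊆ A → h₁ B = 0) (B : Finset V) :
    koszulD o X (fun B => if a ∈ B then h₁ (B.erase a) else h₀ B) B =
      if a ∈ B then koszulD o X h₁ (B.erase a)
      else koszulD o X h₀ B + (-1) ^ #B * X a * h₁ B := by
  unfold koszulD
  split_ifs with haB
  · have e : (B.erase a)ᶜ = insert a Bᶜ := by ext; simp
    rw [e, Finset.sum_insert (by simp [haB]), Finset.insert_erase haB, hh₁ B fun h => ha (h haB),
      mul_zero, zero_add]
    refine Finset.sum_congr rfl fun x hx => ?_
    rw [Finset.mem_compl] at hx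
    have hxa : x ≠ a := by rintro rfl; exact hx haB
    simp only [if_pos (Finset.mem_insert_of_mem haB)]
    rw [Finset.erase_insert_of_ne hxa]
    by_cases hxA : x ∈ A
    · rw [← cubeSign_insert_of_not_lt (z := a) (B := B.erase a) (not_lt.2 (hmax x hxA).le),
        Finset.insert_erase haB]
    · rw [hh₁ _ fun h => hxA (h (Finset.mem_insert_self _ _)), mul_zero, mul_zero]
  · rw [← Finset.sum_erase_add _ _ (Finset.mem_compl.2 haB)]
    congr 1
    · rw [← Finset.sum_erase_add _ (fun x => cubeSign R o x B * X x * h₀ (insert x B))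
        (Finset.mem_compl.2 haB), hh₀ (insert a B) fun h => ha (h (Finset.mem_insert_self _ _)),
        mul_zero, add_zero]
      refine Finset.sum_congr rfl fun x hx => ?_
      simp only [Finset.mem_erase] at hx
      simp [haB, Ne.symm hx.1]
    · simp only [if_pos (Finset.mem_insert_self _ _)]
      rw [Finset.erase_insert haB]
      by_cases hBA : B ⊆ A
      · rw [cubeSign, Finset.filter_true_of_mem fun x hx => hmax x (hBA hx)]
      · rw [hh₁ B hBA, mul_zero, mul_zero]

/-- Each `X a` is a nonzerodivisor modulo the span of `X '' A`, so adjoining `a` through the mapping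
cone preserves acyclicity. The condition on `g ∅` accounts for the homology in degree zero, the
quotient by the ideal. -/
theorem exists_koszulD_eq {o : V → ℕ} (ho : Function.Injective o) {X : V → R}
    (hP : ∀ A : Finset V, (Ideal.span (X '' A)).IsPrime)
    (hX : ∀ (A : Finset V) (a : V), a ∉ A → X a ∉ Ideal.span (X '' A)) (A : Finset V) :
    ∀ g : Finset V → R, (∀ B, ¬ B ⊆ A → g B = 0) → (∀ B, koszulD o X g B = 0) →
      g ∅ ∈ Ideal.span (X '' A) →
      ∃ h : Finset V → R, (∀ B, ¬ B ⊆ A → h B = 0) ∧ ∀ B, koszulD o X h B = g B := by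
  induction A using Finset.induction_on_max_value o with
  | empty =>
    intro g hg _ h0
    refine ⟨0, fun _ _ => rfl, fun B => ?_⟩
    have : g B = 0 := by
      by_cases hB : B ⊆ ∅
      · rw [Finset.subset_empty.1 hB]
        simpa using h0
      · exact hg B hB
    rw [this]
    simp [koszulD]
  | insert a A ha hmax ih =>
    intro g hg hdg h0
    replace hmax : ∀ x ∈ A, o x < o a := fun x hx =>
      lt_of_le_of_ne (hmax x hx) fun h => ha (ho h ▸ hx)
    set g₀ : Finset V → R := fun B => if a ∈ B then 0 else g B with hg₀
    set g₁ : Finset V → R := fun B => if a ∈ B then 0 else g (insert a B) with hg₁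
    have hsub : ∀ B, a ∉ B → (insert a B ⊆ insert a A ↔ B ⊆ A) := fun B hB =>
      Finset.insert_subset_insert_iff hB
    have hsub' : ∀ B, a ∉ B → (B ⊆ insert a A ↔ B ⊆ A) := fun B hB =>
      Finset.subset_insert_iff_of_notMem hB
    have hs₀ : ∀ B, ¬ B ⊆ A → g₀ B = 0 := fun B hB => by
      simp only [hg₀]
      split_ifs with h
      · rfl
      · exact hg B (by rwa [hsub' B h])
    have hs₁ : ∀ B, ¬ B ⊆ A → g₁ B = 0 := fun B hB => by
      simp only [hg₁]
      split_ifs with h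
      · rfl
      · exact hg _ (by rwa [hsub B h])
    have hglue : g = fun B => if a ∈ B then g₁ (B.erase a) else g₀ B := by
      ext B
      simp only [hg₀, hg₁]
      split_ifs with h h'
      · simp at h'
      · rw [Finset.insert_erase h]
      · rfl
    have hd := fun B => koszulD_glue (X := X) ha hmax hs₀ hs₁ B
    rw [← hglue] at hd
    have hd₁ : ∀ B, koszulD o X g₁ B = 0 := fun B => by
      by_cases hB : a ∈ B
      · exact koszulD_eq_zero hs₁ fun h => ha (h hB)
      · have := hd (insert a B)
        rw [if_pos (Finset.mem_insert_self _ _), hdg, Finset.erase_insert hB] at this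
        exact this.symm
    have hd₀ : ∀ B, koszulD o X g₀ B + (-1) ^ #B * X a * g₁ B = 0 := fun B => by
      by_cases hB : a ∈ B
      · rw [koszulD_eq_zero hs₀ fun h => ha (h hB), hs₁ B fun h => ha (h hB)]
        simp
      · have := hd B
        rw [if_neg hB, hdg] at this
        exact this.symm
    -- In degree zero the cycle condition puts `X a * g₁ ∅` in the prime ideal, which does not
    -- contain `X a`.
    have hg₁0 : g₁ ∅ ∈ Ideal.span (X '' A) := by
      have h1 : koszulD o X g₀ ∅ ∈ Ideal.span (X '' A) := by
        refine Ideal.sum_mem _ fun x _ => ?_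
        by_cases hx : x ∈ A
        · exact Ideal.mul_mem_right _ _ (Ideal.mul_mem_left _ _
            (Ideal.subset_span ⟨x, hx, rfl⟩))
        · rw [hs₀ _ fun h => hx (h (Finset.mem_insert_self _ _)), mul_zero]
          exact Ideal.zero_mem _
      have h2 : X a * g₁ ∅ ∈ Ideal.span (X '' A) := by
        have := hd₀ ∅
        simp only [Finset.card_empty, pow_zero, one_mul] at this
        rw [eq_neg_of_add_eq_zero_right this]
        exact neg_mem h1
      exact ((hP A).mem_or_mem h2).resolve_left (hX A a ha)
    obtain ⟨h₁', hsh₁', hdh₁'⟩ := ih g₁ hs₁ hd₁ hg₁0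
    rw [Finset.coe_insert, Set.image_insert_eq, Ideal.mem_span_insert] at h0
    obtain ⟨q, p, hp, hpq⟩ := h0
    -- The differential never reads the value at `∅`, so that value is free; choosing `q` leaves `p`
    -- as the degree-zero part of `g₀'`, which lies in the ideal.
    set h₁ : Finset V → R := fun B => if B = ∅ then q else h₁' B with hh₁
    have hsh₁ : ∀ B, ¬ B ⊆ A → h₁ B = 0 := fun B hB => by
      simp only [hh₁]
      rw [if_neg, hsh₁' B hB]
      rintro rfl
      exact hB (Finset.empty_subset _)
    have hdh₁ : ∀ B, koszulD o X h₁ B = g₁ B := fun B => by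
      rw [← hdh₁' B]
      refine Finset.sum_congr rfl fun x _ => ?_
      simp [hh₁]
    set g₀' : Finset V → R := fun B => g₀ B - (-1) ^ #B * X a * h₁ B with hg₀'
    have hs₀' : ∀ B, ¬ B ⊆ A → g₀' B = 0 := fun B hB => by
      simp [hg₀', hs₀ B hB, hsh₁ B hB]
    have hd₀' : ∀ B, koszulD o X g₀' B = 0 := fun B => by
      rw [← hd₀ B, ← hdh₁ B]
      simp only [koszulD, Finset.mul_sum, ← Finset.sum_add_distrib]
      refine Finset.sum_congr rfl fun x hx => ?_
      simp only [hg₀']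
      rw [Finset.card_insert_of_notMem (Finset.mem_compl.1 hx)]
      ring
    have hg₀'0 : g₀' ∅ ∈ Ideal.span (X '' A) := by
      have : g₀' ∅ = p := by
        simp [hg₀', hg₀, hh₁, hpq]
        ring
      rwa [this]
    obtain ⟨h₀, hsh₀, hdh₀⟩ := ih g₀' hs₀' hd₀' hg₀'0
    refine ⟨fun B => if a ∈ B then h₁ (B.erase a) else h₀ B, fun B hB => ?_, fun B => ?_⟩
    · dsimp only
      split_ifs with h
      · refine hsh₁ _ fun h' => hB ?_
        rwa [Finset.subset_insert_iff]
      · exact hsh₀ _ (by rwa [← hsub' B h])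
    · rw [koszulD_glue ha hmax hsh₀ hsh₁, hglue, hdh₀, hdh₁]
      by_cases h : a ∈ B
      · simp [h]
      · simp [hg₀', h]

/-- The coefficients of the cubical differential. -/
def cubeCoeff (X Y : V → R) (x : V) (A : Finset V) : R := if x ∈ A then X x else -Y x

/-- The cubical differential; a function `f` stands for `∑ (A, B), f (A, B) • e (A, B)`, and
`(A, B)` for the cube of all sets between `A \ B` and `A`. -/
def cubeD (o : V → ℕ) (X Y : V → R) :
    (Finset V × Finset V → R) →ₗ[R] (Finset V × Finset V → R) where
  toFun f p := ∑ x ∈ p.2ᶜ, cubeSign R o x p.2 * cubeCoeff X Y x p.1 * f (insert x p.1, insert x p.2)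
  map_add' f g := by
    ext p
    simp [mul_add, Finset.sum_add_distrib]
  map_smul' c f := by
    ext p
    simp only [Pi.smul_apply, smul_eq_mul, RingHom.id_apply, Finset.mul_sum]
    exact Finset.sum_congr rfl fun x _ => by ring

theorem cubeD_apply (o : V → ℕ) (X Y : V → R) (f : Finset V × Finset V → R)
    (p : Finset V × Finset V) : cubeD o X Y f p =
    ∑ x ∈ p.2ᶜ, cubeSign R o x p.2 * cubeCoeff X Y x p.1 * f (insert x p.1, insert x p.2) := rfl

/-- Removing `x` and `z` in the two orders gives the same coefficients with opposite signs. -/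
theorem cubeD_cubeD {o : V → ℕ} (ho : Function.Injective o) (X Y : V → R)
    (f : Finset V × Finset V → R) : cubeD o X Y (cubeD o X Y f) = 0 := by
  ext ⟨A, B⟩
  simp only [cubeD_apply, Finset.mul_sum, Pi.zero_apply]
  rw [Finset.sum_sigma']
  refine Finset.sum_involution (fun p _ => ⟨p.2, p.1⟩) ?_ ?_ ?_ ?_
  · rintro ⟨x, z⟩ h
    simp only [Finset.mem_sigma, Finset.mem_compl, Finset.mem_insert, not_or] at h
    obtain ⟨hx, hzx, hz⟩ := h
    have h1 : cubeCoeff X Y z (insert x A) = cubeCoeff X Y z A := by simp [cubeCoeff, hzx]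
    have h2 : cubeCoeff X Y x (insert z A) = cubeCoeff X Y x A := by
      simp [cubeCoeff, Ne.symm hzx]
    simp only [h1, h2, Finset.insert_comm x z]
    have := cubeSign_mul_comm (R := R) ho hx hz (Ne.symm hzx)
    linear_combination cubeCoeff X Y x A * cubeCoeff X Y z A *
      f (insert z (insert x A), insert z (insert x B)) * this
  · rintro ⟨x, z⟩ h _ h'
    simp only [Finset.mem_sigma, Finset.mem_compl, Finset.mem_insert, not_or] at h
    simp only [Sigma.mk.injEq, heq_eq_eq] at h'
    exact h.2.1 h'.1
  · rintro ⟨x, z⟩ h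
    simp only [Finset.mem_sigma, Finset.mem_compl, Finset.mem_insert, not_or] at h ⊢
    exact ⟨h.2.2, Ne.symm h.2.1, h.1⟩
  · rintro ⟨x, z⟩ _
    rfl

/-- The monomials `∏_{x ∉ A} X x ∏_{x ∈ A} Y x`. -/
def cubeMonomial (X Y : V → R) (A : Finset V) : R := (∏ x ∈ Aᶜ, X x) * ∏ x ∈ A, Y x

/-- The augmentation of the cubical complex. -/
def cubeAug (X Y : V → R) : (Finset V × Finset V → R) →ₗ[R] R where
  toFun f := ∑ A, f (A, ∅) * cubeMonomial X Y A
  map_add' f g := by simp [add_mul, Finset.sum_add_distrib]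
  map_smul' c f := by simp [Finset.mul_sum, mul_assoc]

theorem cubeAug_apply (X Y : V → R) (f : Finset V × Finset V → R) :
    cubeAug X Y f = ∑ A, f (A, ∅) * cubeMonomial X Y A := rfl

/-- This syzygy between the two ends of an edge is what makes the augmentation kill boundaries. -/
theorem cubeMonomial_insert (X Y : V → R) {x : V} {A : Finset V} (hx : x ∉ A) :
    X x * cubeMonomial X Y (insert x A) = Y x * cubeMonomial X Y A := by
  have : Aᶜ = insert x (insert x A)ᶜ := by ext y; by_cases h : y = x <;> simp [h, hx]
  rw [cubeMonomial, cubeMonomial, Finset.prod_insert hx, this, Finset.prod_insert (by simp)]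
  ring

theorem cubeAug_cubeD (o : V → ℕ) (X Y : V → R) (f : Finset V × Finset V → R) :
    cubeAug X Y (cubeD o X Y f) = 0 := by
  simp only [cubeAug_apply, cubeD_apply, Finset.sum_mul]
  rw [Finset.sum_comm]
  refine Finset.sum_eq_zero fun x _ => ?_
  -- The two endpoints of each edge in direction `x` cancel.
  refine Finset.sum_involution (fun A _ => if x ∈ A then A.erase x else insert x A) ?_ ?_ ?_ ?_
  · intro A _
    split_ifs with h
    · have := cubeMonomial_insert X Y (Finset.notMem_erase x A)
      rw [Finset.insert_erase h] at this
      simp only [Finset.insert_eq_of_mem h, Finset.insert_erase h, cubeCoeff, h, if_true,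
        Finset.notMem_erase, if_false]
      linear_combination cubeSign R o x ∅ * f (A, insert x ∅) * this
    · have := cubeMonomial_insert X Y h
      simp only [cubeCoeff, h, if_false, Finset.mem_insert_self, if_true, Finset.insert_idem]
      linear_combination cubeSign R o x ∅ * f (insert x A, insert x ∅) * this
  · intro A _ _ h
    split_ifs at h with h'
    · exact Finset.notMem_erase x A (h.symm ▸ h')
    · exact h' (h ▸ Finset.mem_insert_self x A)
  · simp
  · intro A _
    by_cases h : x ∈ A
    · simp [h, Finset.insert_erase]
    · simp [h]

theorem exists_of_cubeD_ne_zero {o : V → ℕ} {X Y : V → R} {f : Finset V × Finset V → R}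
    {p : Finset V × Finset V} (h : cubeD o X Y f p ≠ 0) :
    ∃ x, x ∉ p.2 ∧ f (insert x p.1, insert x p.2) ≠ 0 := by
  rw [cubeD_apply] at h
  obtain ⟨x, hx, h⟩ := Finset.exists_ne_zero_of_sum_ne_zero h
  exact ⟨x, Finset.mem_compl.1 hx, right_ne_zero_of_mul h⟩

theorem CubeSupported.map_cubeD {Δ : Finset (Finset V)} (hΔ : ∀ A ∈ Δ, ∀ B ⊆ A, B ∈ Δ) {o : V → ℕ}
    {X Y : V → R} {f : Finset V × Finset V → R} (hf : CubeSupported Δ f) :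
    CubeSupported Δ (cubeD o X Y f) := fun p hp => by
  obtain ⟨x, hx, hfx⟩ := exists_of_cubeD_ne_zero hp
  obtain ⟨h1, h2⟩ := hf _ hfx
  exact ⟨(Finset.insert_subset_insert_iff hx).1 h1, hΔ _ h2 _ (Finset.subset_insert _ _)⟩

theorem cubeMonomial_mem_span {X Y : V → R} {A A' : Finset V} (h : ¬ A ⊆ A') :
    cubeMonomial X Y A' ∈ Ideal.span (X '' A) := by
  obtain ⟨x, hxA, hxA'⟩ := Finset.not_subset.1 h
  refine Ideal.mul_mem_right _ _ (Ideal.mem_of_dvd _ (Finset.dvd_prod_of_mem X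
    (Finset.mem_compl.2 hxA')) (Ideal.subset_span ⟨x, hxA, rfl⟩))

theorem cubeMonomial_notMem_span {X Y : V → R} {A : Finset V}
    (hP : (Ideal.span (X '' A)).IsPrime)
    (hX : ∀ a, a ∉ A → X a ∉ Ideal.span (X '' A)) (hY : ∀ a ∈ A, Y a ∉ Ideal.span (X '' A)) :
    cubeMonomial X Y A ∉ Ideal.span (X '' A) := by
  intro h
  rcases hP.mem_or_mem h with h | h
  · obtain ⟨x, hx, h⟩ := (hP.prod_mem_iff).1 h
    exact hX x (Finset.mem_compl.1 hx) h
  · obtain ⟨x, hx, h⟩ := (hP.prod_mem_iff).1 h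
    exact hY x hx h

/-- Remove a facet `A` of `Δ`: the part of the cycle over `A` is a Koszul cycle, hence a Koszul
boundary, and subtracting the corresponding cubical boundary leaves a cycle supported on the smaller
complex. -/
theorem exists_cubeD_eq {o : V → ℕ} (ho : Function.Injective o) {X Y : V → R}
    (hP : ∀ A : Finset V, (Ideal.span (X '' A)).IsPrime)
    (hX : ∀ (A : Finset V) (a : V), a ∉ A → X a ∉ Ideal.span (X '' A))
    (hY : ∀ (A : Finset V), ∀ a ∈ A, Y a ∉ Ideal.span (X '' A)) (Δ : Finset (Finset V)) :
    (∀ A ∈ Δ, ∀ B ⊆ A, B ∈ Δ) → ∀ f : Finset V × Finset V → R, CubeSupported Δ f →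
      cubeD o X Y f = 0 → cubeAug X Y f = 0 →
      ∃ h, CubeSupported Δ h ∧ cubeD o X Y h = f := by
  induction Δ using Finset.strongInduction with
  | H Δ ih =>
    intro hΔ f hf hdf haf
    rcases Δ.eq_empty_or_nonempty with rfl | hne
    · refine ⟨0, fun p hp => absurd rfl hp, ?_⟩
      rw [map_zero]
      ext p
      by_contra h
      simpa using hf p (Ne.symm h)
    obtain ⟨A, hA⟩ := Δ.exists_maximal hne
    have hmax : ∀ A' ∈ Δ, A ⊆ A' → A' = A := fun A' hA' h =>
      (hA.eq_of_le hA' h).symm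
    set g : Finset V → R := fun B => f (A, B) with hg
    have hsg : ∀ B, ¬ B ⊆ A → g B = 0 := fun B hB => by
      by_contra h
      exact hB (hf _ h).1
    -- on the facet `A` the cubical differential is the Koszul differential
    have hres : ∀ k : Finset V × Finset V → R, CubeSupported Δ k → ∀ B,
        cubeD o X Y k (A, B) = koszulD o X (fun B => k (A, B)) B := fun k hk B => by
      rw [cubeD_apply, koszulD]
      refine Finset.sum_congr rfl fun x _ => ?_
      by_cases hx : x ∈ A
      · simp [cubeCoeff, hx]
      -- For `x ∉ A` both summands vanish: one by maximality of `A`, the other because `insert x B`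
      -- is not contained in `A`.
      · have h1 : k (insert x A, insert x B) = 0 := by
          by_contra h
          exact hx (hmax _ (hk _ h).2 (Finset.subset_insert _ _) ▸ Finset.mem_insert_self _ _)
        have h2 : k (A, insert x B) = 0 := by
          by_contra h
          exact hx ((hk _ h).1 (Finset.mem_insert_self _ _))
        simp [h1, h2]
    have hdg : ∀ B, koszulD o X g B = 0 := fun B => by
      rw [← hres f hf, hdf, Pi.zero_apply]
    -- Modulo this prime, the generators of all faces other than the facet `A` vanish, while that of
    -- `A` does not; so `haf` forces `g ∅` into the ideal.
    have hg0 : g ∅ ∈ Ideal.span (X '' A) := by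
      rw [cubeAug_apply, ← Finset.add_sum_erase _ _ (Finset.mem_univ A)] at haf
      have : g ∅ * cubeMonomial X Y A ∈ Ideal.span (X '' A) := by
        rw [eq_neg_of_add_eq_zero_left haf]
        refine neg_mem (Ideal.sum_mem _ fun A' hA' => ?_)
        by_cases h : f (A', ∅) = 0
        · rw [h, zero_mul]
          exact Ideal.zero_mem _
        · exact Ideal.mul_mem_left _ _ (cubeMonomial_mem_span fun h' =>
            (Finset.mem_erase.1 hA').1 (hmax A' (hf _ h).2 h'))
      exact ((hP A).mem_or_mem this).resolve_right
        (cubeMonomial_notMem_span (hP A) (hX A) (hY A))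
    obtain ⟨k, hsk, hdk⟩ := exists_koszulD_eq ho hP hX A g hsg hdg hg0
    set k' : Finset V × Finset V → R := fun p => if p.1 = A then k p.2 else 0 with hk'
    have hsk' : CubeSupported Δ k' := fun p hp => by
      simp only [hk'] at hp
      split_ifs at hp with h
      · refine ⟨?_, h ▸ hA.prop⟩
        by_contra h'
        exact hp (hsk _ (h ▸ h'))
      · exact absurd rfl hp
    set f' := f - cubeD o X Y k' with hf'
    have hsf' : CubeSupported (Δ.erase A) f' := fun p hp => by
      have hpA : p.1 ≠ A := by
        rintro h
        apply hp
        obtain ⟨A', B⟩ := p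
        obtain rfl : A' = A := h
        rw [hf', Pi.sub_apply, hres k' hsk', sub_eq_zero]
        simp only [hk', if_true]
        exact (hdk B).symm
      have : p.2 ⊆ p.1 ∧ p.1 ∈ Δ := by
        by_cases h : f p = 0
        · refine hsk'.map_cubeD hΔ (o := o) (X := X) (Y := Y) p fun h' => hp ?_
          rw [hf', Pi.sub_apply, h, h', sub_zero]
        · exact hf p h
      exact ⟨this.1, Finset.mem_erase.2 ⟨hpA, this.2⟩⟩
    obtain ⟨h, hsh, hdh⟩ := ih (Δ.erase A) (Finset.erase_ssubset hA.prop)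
      (fun A' hA' B hB => by
        rw [Finset.mem_erase] at hA' ⊢
        refine ⟨?_, hΔ A' hA'.2 B hB⟩
        rintro rfl
        exact hA'.1 (hmax A' hA'.2 hB)) f' hsf'
      (by rw [hf', map_sub, hdf, cubeD_cubeD ho, sub_zero])
      (by rw [hf', map_sub, haf, cubeAug_cubeD, sub_zero])
    refine ⟨h + k', fun p hp => ?_, by rw [map_add, hdh, hf', sub_add_cancel]⟩
    by_cases h1 : h p = 0
    · refine hsk' p fun h2 => hp ?_
      rw [Pi.add_apply, h1, h2, add_zero]
    · exact ⟨(hsh p h1).1, Finset.mem_of_mem_erase (hsh p h1).2⟩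

end Cubes

/-! ### Ideals generated by variables. -/

section VariableIdeals

variable {σ : Type*} {K : Type*} [Field K]

/-- The ideal is the kernel of the substitution sending the variables in `s` to zero, an
endomorphism of a domain. -/
theorem isPrime_span_X_image (s : Set σ) :
    (Ideal.span (MvPolynomial.X '' s : Set (MvPolynomial σ K))).IsPrime := by
  classical
  let φ : MvPolynomial σ K →ₐ[K] MvPolynomial σ K :=
    MvPolynomial.aeval fun i => if i ∈ s then 0 else MvPolynomial.X i
  have h : Ideal.span (MvPolynomial.X '' s : Set (MvPolynomial σ K)) = RingHom.ker φ := by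
    refine le_antisymm (Ideal.span_le.2 ?_) fun p hp => ?_
    · rintro _ ⟨i, hi, rfl⟩
      simp [φ, hi]
    · have key : ∀ p, p - φ p ∈ Ideal.span (MvPolynomial.X '' s : Set (MvPolynomial σ K)) := by
        intro p
        induction p using MvPolynomial.induction_on with
        | C a => simp [φ]
        | add p q hp hq =>
          rw [map_add, add_sub_add_comm]
          exact Ideal.add_mem _ hp hq
        | mul_X p i hp =>
          have hi : MvPolynomial.X i - φ (MvPolynomial.X i) ∈
              Ideal.span (MvPolynomial.X '' s : Set (MvPolynomial σ K)) := by
            by_cases hi : i ∈ s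
            · simpa [φ, hi] using Ideal.subset_span (Set.mem_image_of_mem MvPolynomial.X hi)
            · simp [φ, hi]
          have : p * MvPolynomial.X i - φ (p * MvPolynomial.X i) =
              (p - φ p) * MvPolynomial.X i + φ p * (MvPolynomial.X i - φ (MvPolynomial.X i)) := by
            rw [map_mul]
            ring
          rw [this]
          exact Ideal.add_mem _ (Ideal.mul_mem_right _ _ hp) (Ideal.mul_mem_left _ _ hi)
      have := key p
      rwa [(RingHom.mem_ker).1 hp, sub_zero] at this
  rw [h]
  exact RingHom.ker_isPrime _

theorem X_mem_span_X_image {s : Set σ} {i : σ} :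
    (MvPolynomial.X i : MvPolynomial σ K) ∈ Ideal.span (MvPolynomial.X '' s) ↔ i ∈ s := by
  classical
  rw [MvPolynomial.mem_ideal_span_X_image]
  simp [MvPolynomial.support_X, Finsupp.single_apply]

theorem HomogeneousOfDegree.zero (d : ℤ) : HomogeneousOfDegree (0 : MvPolynomial σ K) d := by
  intro m hm
  simp at hm

theorem HomogeneousOfDegree.prod_X {ι : Type*} (s : Finset ι) (f : ι → σ) :
    HomogeneousOfDegree (∏ i ∈ s, (MvPolynomial.X (f i) : MvPolynomial σ K)) #s := by
  classical
  induction s using Finset.induction_on with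
  | empty =>
    intro m hm
    simp only [Finset.prod_empty, MvPolynomial.mem_support_iff, MvPolynomial.coeff_one] at hm
    obtain rfl : 0 = m := by_contra fun h => hm (if_neg h)
    simp
  | insert a s ha ih =>
    rw [Finset.prod_insert ha, Finset.card_insert_of_notMem ha, Nat.cast_add, add_comm]
    refine HomogeneousOfDegree.mul (fun m hm => ?_) ih
    rw [MvPolynomial.support_X, Finset.mem_singleton] at hm
    simp [hm]

end VariableIdeals

/-! ### Extension by zero and restriction of functions. -/

section Extension

variable {T : Type*} {R : Type*} [CommRing R] (P : T → Prop)

open Classical in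
/-- Extension by zero of a function on a subtype. -/
noncomputable def extendZero : ({t // P t} →₀ R) →ₗ[R] (T → R) where
  toFun f t := if h : P t then f ⟨t, h⟩ else 0
  map_add' f g := by
    ext t
    by_cases h : P t <;> simp [h]
  map_smul' c f := by
    ext t
    by_cases h : P t <;> simp [h]

/-- Restriction of a function to a finite subtype. -/
noncomputable def restrictFinsupp [Finite T] : (T → R) →ₗ[R] ({t // P t} →₀ R) :=
  (Finsupp.linearEquivFunOnFinite R R {t // P t}).symm.toLinearMap ∘ₗ
    LinearMap.funLeft R R Subtype.val

variable {P}

theorem extendZero_apply_of_pos (f : {t // P t} →₀ R) {t : T} (h : P t) :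
    extendZero P f t = f ⟨t, h⟩ := dif_pos h

theorem extendZero_apply_of_neg (f : {t // P t} →₀ R) {t : T} (h : ¬ P t) :
    extendZero P f t = 0 := dif_neg h

theorem extendZero_single [DecidableEq T] (e : {t // P t}) (t : T) :
    extendZero P (Finsupp.single e (1 : R)) t = if t = e.1 then 1 else 0 := by
  by_cases h : P t
  · rw [extendZero_apply_of_pos _ h, Finsupp.single_apply]
    simp [Subtype.ext_iff, eq_comm]
  · rw [extendZero_apply_of_neg _ h, if_neg]
    rintro rfl
    exact h e.2

theorem restrictFinsupp_apply [Finite T] (f : T → R) (t : {t // P t}) :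
    restrictFinsupp P f t = f t.1 := rfl

theorem extendZero_restrictFinsupp [Finite T] (f : T → R) {t : T} (h : f t ≠ 0 → P t) :
    extendZero P (restrictFinsupp P f) t = f t := by
  by_cases ht : P t
  · rw [extendZero_apply_of_pos _ ht, restrictFinsupp_apply]
  · rw [extendZero_apply_of_neg _ ht]
    by_contra h'
    exact ht (h (Ne.symm h'))

theorem restrictFinsupp_extendZero [Finite T] (f : {t // P t} →₀ R) :
    restrictFinsupp P (extendZero P f) = f := by
  ext t
  rw [restrictFinsupp_apply, extendZero_apply_of_pos _ t.2]

end Extension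

/-! ### The cubical complex split by dimension. -/

section CubicalComplex

variable {V : Type*} {R : Type*} [CommRing R]

/-- The pairs `(A, B)` indexing the cubes of dimension `i`. -/
def IsCube (Δ : Finset (Finset V)) (i : ℕ) (p : Finset V × Finset V) : Prop :=
  (p.2 ⊆ p.1 ∧ p.1 ∈ Δ) ∧ #p.2 = i

theorem cubeSupported_extendZero {Δ : Finset (Finset V)} (i : ℕ)
    (f : {p // IsCube Δ i p} →₀ R) :
    CubeSupported Δ (extendZero _ f) := fun p hp => by
  by_contra h
  exact hp (extendZero_apply_of_neg _ fun h' => h h'.1)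

variable [Fintype V] [DecidableEq V]

/-- The differential of the cubical complex in dimension `i + 1`. -/
noncomputable def cubicalD (o : V → ℕ) (X Y : V → R) (Δ : Finset (Finset V)) (i : ℕ) :
    ({p // IsCube Δ (i + 1) p} →₀ R) →ₗ[R] ({p // IsCube Δ i p} →₀ R) :=
  restrictFinsupp _ ∘ₗ cubeD o X Y ∘ₗ extendZero _

variable {o : V → ℕ} {X Y : V → R} {Δ : Finset (Finset V)}

theorem cubicalD_apply (i : ℕ) (f : {p // IsCube Δ (i + 1) p} →₀ R) (p : {p // IsCube Δ i p}) :
    cubicalD o X Y Δ i f p = cubeD o X Y (extendZero _ f) p.1 := rfl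

/-- The differential keeps the support in `Δ` and lowers dimension by exactly one, so restricting to
dimension `i` loses nothing. -/
theorem extendZero_cubicalD (hΔ : ∀ A ∈ Δ, ∀ B ⊆ A, B ∈ Δ) (i : ℕ)
    (f : {p // IsCube Δ (i + 1) p} →₀ R) :
    extendZero _ (cubicalD o X Y Δ i f) = cubeD o X Y (extendZero _ f) := by
  ext p
  refine extendZero_restrictFinsupp _ fun hp => ?_
  refine ⟨(cubeSupported_extendZero _ f).map_cubeD hΔ p hp, ?_⟩
  obtain ⟨x, hx, hfx⟩ := exists_of_cubeD_ne_zero hp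
  have : IsCube Δ (i + 1) (insert x p.1, insert x p.2) := by
    by_contra h
    exact hfx (extendZero_apply_of_neg _ h)
  have := this.2
  rw [Finset.card_insert_of_notMem hx] at this
  omega

theorem cubicalD_restrictFinsupp {h : Finset V × Finset V → R} (hh : CubeSupported Δ h) (i : ℕ) :
    cubicalD o X Y Δ i (restrictFinsupp _ h) = restrictFinsupp _ (cubeD o X Y h) := by
  ext ⟨p, hp⟩
  rw [cubicalD_apply, restrictFinsupp_apply, cubeD_apply, cubeD_apply]
  refine Finset.sum_congr rfl fun x hx => ?_
  rw [extendZero_restrictFinsupp]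
  intro hne
  refine ⟨hh _ hne, ?_⟩
  rw [Finset.card_insert_of_notMem (Finset.mem_compl.1 hx), hp.2]

/-- A preimage of mixed dimension may be replaced by its part in dimension `i + 1`. -/
theorem exact_cubicalD (ho : Function.Injective o)
    (hP : ∀ A : Finset V, (Ideal.span (X '' A)).IsPrime)
    (hX : ∀ (A : Finset V) (a : V), a ∉ A → X a ∉ Ideal.span (X '' A))
    (hY : ∀ (A : Finset V), ∀ a ∈ A, Y a ∉ Ideal.span (X '' A))
    (hΔ : ∀ A ∈ Δ, ∀ B ⊆ A, B ∈ Δ) (i : ℕ) (f : {p // IsCube Δ i p} →₀ R)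
    (hf : cubeD o X Y (extendZero _ f) = 0) (haf : cubeAug X Y (extendZero _ f) = 0) :
    f ∈ LinearMap.range (cubicalD o X Y Δ i) := by
  obtain ⟨h, hsh, hdh⟩ := exists_cubeD_eq ho hP hX hY Δ hΔ _ (cubeSupported_extendZero i f) hf haf
  refine ⟨restrictFinsupp _ h, ?_⟩
  rw [cubicalD_restrictFinsupp hsh, hdh, restrictFinsupp_extendZero]

theorem cubeAug_extendZero_succ (i : ℕ) (f : {p // IsCube Δ (i + 1) p} →₀ R) :
    cubeAug X Y (extendZero _ f) = 0 := by
  refine Finset.sum_eq_zero fun A _ => ?_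
  rw [extendZero_apply_of_neg _ fun h => ?_, zero_mul]
  have := h.2
  simp at this

theorem range_cubeAug_extendZero :
    LinearMap.range (cubeAug X Y ∘ₗ extendZero (IsCube Δ 0)) =
      Ideal.span (cubeMonomial X Y '' Δ) := by
  refine le_antisymm ?_ (Ideal.span_le.2 ?_)
  · rintro _ ⟨f, rfl⟩
    refine Ideal.sum_mem _ fun A _ => ?_
    by_cases h : IsCube Δ 0 (A, ∅)
    · exact Ideal.mul_mem_left _ _ (Ideal.subset_span ⟨A, h.1.2, rfl⟩)
    · rw [extendZero_apply_of_neg _ h, zero_mul]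
      exact Ideal.zero_mem _
  · rintro _ ⟨A, hA, rfl⟩
    refine ⟨Finsupp.single ⟨(A, ∅), ⟨Finset.empty_subset _, hA⟩, rfl⟩ 1, ?_⟩
    rw [LinearMap.comp_apply, cubeAug_apply]
    simp [extendZero_single]

end CubicalComplex

/-! ### The graded cubical resolution, its minimality and its ranks. -/

section CubicalResolution

variable {V : Type u} {Z : Type} {K : Type v} [Field K]

/-- The variable of an old vertex. -/
noncomputable def oldVariable (K : Type v) [Field K] (Z : Type) (x : V) : MvPolynomial (V ⊕ Z) K :=
  MvPolynomial.X (Sum.inl x)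

/-- The product of the variables of the new vertices in `N x`. -/
noncomputable def newMonomial (K : Type v) [Field K] (N : V → Finset Z) (x : V) :
    MvPolynomial (V ⊕ Z) K :=
  ∏ w ∈ N x, MvPolynomial.X (Sum.inr w)

theorem image_oldVariable (A : Finset V) :
    oldVariable K Z '' (A : Set V) = MvPolynomial.X '' (Sum.inl '' (A : Set V)) := by
  rw [Set.image_image]
  rfl

theorem isPrime_span_oldVariable (A : Finset V) :
    (Ideal.span (oldVariable K Z '' (A : Set V))).IsPrime := by
  rw [image_oldVariable]
  exact isPrime_span_X_image _

theorem oldVariable_notMem_span (A : Finset V) (a : V) (ha : a ∉ A) :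
    oldVariable K Z a ∉ Ideal.span (oldVariable K Z '' (A : Set V)) := by
  rw [image_oldVariable, oldVariable, X_mem_span_X_image]
  simpa using ha

theorem newMonomial_notMem_span (N : V → Finset Z) (A : Finset V) (a : V) :
    newMonomial K N a ∉ Ideal.span (oldVariable K Z '' (A : Set V)) := by
  intro h
  obtain ⟨w, -, hw⟩ := (isPrime_span_oldVariable A).prod_mem_iff.1 h
  rw [image_oldVariable, X_mem_span_X_image] at hw
  simp at hw

theorem homogeneousOfDegree_cubeSign_mul {σ : Type*} (o : V → ℕ) (x : V) (B : Finset V)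
    {p : MvPolynomial σ K} {d : ℤ} (hp : HomogeneousOfDegree p d) :
    HomogeneousOfDegree (cubeSign (MvPolynomial σ K) o x B * p) d := by
  rcases neg_one_pow_eq_or (MvPolynomial σ K) #{y ∈ B | o y < o x} with h | h
  · rwa [cubeSign, h, one_mul]
  · rw [cubeSign, h, neg_one_mul]
    exact hp.neg

variable [Fintype V] [DecidableEq V]

/-- The degree of `cubeMonomial (oldVariable K Z) (newMonomial K N) A`. -/
def cubeDegree (N : V → Finset Z) (A : Finset V) : ℕ := #Aᶜ + ∑ x ∈ A, #(N x)

theorem cubeDegree_insert (N : V → Finset Z) {x : V} {A : Finset V} (hx : x ∉ A) :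
    cubeDegree N (insert x A) + 1 = cubeDegree N A + #(N x) := by
  have : Aᶜ = insert x (insert x A)ᶜ := by ext y; by_cases h : y = x <;> simp [h, hx]
  rw [cubeDegree, cubeDegree, Finset.sum_insert hx, this, Finset.card_insert_of_notMem (by simp)]
  ring

theorem homogeneousOfDegree_cubeMonomial (N : V → Finset Z) (A : Finset V) :
    HomogeneousOfDegree (cubeMonomial (oldVariable K Z) (newMonomial K N) A)
      (cubeDegree N A) := by
  rw [cubeMonomial, cubeDegree, Nat.cast_add]
  refine (HomogeneousOfDegree.prod_X _ _).mul ?_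
  simp only [newMonomial]
  rw [Finset.prod_sigma' A N, ← Finset.card_sigma]
  exact HomogeneousOfDegree.prod_X _ fun p : (_ : V) × Z => Sum.inr p.2

/-- One formula covers both cases: the degree is `1` if `x ∈ A`, and `#(N x)` otherwise. -/
theorem homogeneousOfDegree_cubeCoeff (N : V → Finset Z) (x : V) (A : Finset V) :
    HomogeneousOfDegree (cubeCoeff (oldVariable K Z) (newMonomial K N) x A)
      (cubeDegree N (insert x A) + 1 - cubeDegree N A) := by
  rw [cubeCoeff]
  split_ifs with h
  · rw [Finset.insert_eq_of_mem h, add_sub_cancel_left]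
    simpa [oldVariable] using HomogeneousOfDegree.prod_X (K := K) {x} (Sum.inl : V → V ⊕ Z)
  · have : (cubeDegree N (insert x A) + 1 - cubeDegree N A : ℤ) = #(N x) := by
      have := cubeDegree_insert N h
      omega
    rw [this]
    exact (HomogeneousOfDegree.prod_X _ _).neg

/-- The cubical resolution of the ideal generated by the `cubeMonomial`s of the faces of a
simplicial complex. -/
noncomputable def cubicalResolution (K : Type v) [Field K] {o : V → ℕ} (ho : Function.Injective o)
    (N : V → Finset Z) {Δ : Finset (Finset V)} (hΔ : ∀ A ∈ Δ, ∀ B ⊆ A, B ∈ Δ) :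
    GradedFreeResolution
      (Ideal.span (cubeMonomial (oldVariable K Z) (newMonomial K N) '' Δ)) where
  gen i := {p // IsCube Δ i p}
  finite_gen i := inferInstance
  -- The cube `(A, B)` carries the degree of `m_A * ∏ x ∈ B, X x`.
  deg i e := cubeDegree N e.1.1 + i
  aug := cubeAug _ _ ∘ₗ extendZero _
  d := cubicalD o _ _ Δ
  aug_homogeneous e := by
    rw [LinearMap.comp_apply, cubeAug_apply]
    refine HomogeneousOfDegree.sum _ _ fun A _ => ?_
    rw [extendZero_single]
    split_ifs with h
    · rw [one_mul, ← h]
      simpa using homogeneousOfDegree_cubeMonomial N A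
    · rw [zero_mul]
      exact HomogeneousOfDegree.zero _
  d_homogeneous i e f := by
    rw [cubicalD_apply, cubeD_apply]
    refine HomogeneousOfDegree.sum _ _ fun x _ => ?_
    rw [extendZero_single]
    split_ifs with h
    · rw [mul_one, ← h]
      refine homogeneousOfDegree_cubeSign_mul _ _ _ ?_
      convert homogeneousOfDegree_cubeCoeff N x f.1.1 using 1
      push_cast
      ring
    · rw [mul_zero]
      exact HomogeneousOfDegree.zero _
  range_aug := range_cubeAug_extendZero
  exact_zero f := by
    constructor
    · intro hf
      refine exact_cubicalD ho isPrime_span_oldVariable oldVariable_notMem_span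
        (fun A a _ => newMonomial_notMem_span N A a) hΔ 0 f ?_ hf
      ext1 p
      by_contra hp
      obtain ⟨x, hx, hfx⟩ := exists_of_cubeD_ne_zero hp
      have : IsCube Δ 0 (insert x p.1, insert x p.2) := by
        by_contra h
        exact hfx (extendZero_apply_of_neg _ h)
      simpa using this.2
    · rintro ⟨g, rfl⟩
      rw [LinearMap.comp_apply, extendZero_cubicalD hΔ, cubeAug_cubeD]
  exact_succ i f := by
    constructor
    · intro hf
      refine exact_cubicalD ho isPrime_span_oldVariable oldVariable_notMem_span
        (fun A a _ => newMonomial_notMem_span N A a) hΔ (i + 1) f ?_ (cubeAug_extendZero_succ i f)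
      rw [← extendZero_cubicalD hΔ, hf, map_zero]
    · rintro ⟨g, rfl⟩
      rw [cubicalD, LinearMap.comp_apply, LinearMap.comp_apply, extendZero_cubicalD hΔ,
        cubeD_cubeD ho, map_zero]

/-- Nonemptiness of `N x` prevents the coefficient `-Y x` from being a unit. -/
theorem cubicalResolution_isMinimal {o : V → ℕ} (ho : Function.Injective o)
    {N : V → Finset Z} (hN : ∀ x, (N x).Nonempty) {Δ : Finset (Finset V)}
    (hΔ : ∀ A ∈ Δ, ∀ B ⊆ A, B ∈ Δ) : (cubicalResolution K ho N hΔ).IsMinimal := by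
  intro i f p
  change cubeD _ _ _ _ _ ∈ _
  rw [cubeD_apply]
  refine Ideal.sum_mem _ fun x _ => Ideal.mul_mem_right _ _ (Ideal.mul_mem_left _ _ ?_)
  rw [cubeCoeff]
  split_ifs
  · exact Ideal.subset_span ⟨_, rfl⟩
  · obtain ⟨w, hw⟩ := hN x
    exact neg_mem (Ideal.mem_of_dvd _ (Finset.dvd_prod_of_mem _ hw) (Ideal.subset_span ⟨_, rfl⟩))

/-- For each face `A` of the right degree, the cubes `(A, B)` are given by the subsets `B` of `A`
with `i` elements. -/
theorem cubicalResolution_rank {o : V → ℕ} (ho : Function.Injective o)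
    (N : V → Finset Z) {Δ : Finset (Finset V)}
    (hΔ : ∀ A ∈ Δ, ∀ B ⊆ A, B ∈ Δ) (i : ℕ) (j : ℤ) :
    (cubicalResolution K ho N hΔ).rank i (i + j) =
      ∑ A ∈ Δ with (cubeDegree N A : ℤ) = j, (#A).choose i := by
  simp_rw [← Finset.card_powersetCard]
  rw [← Finset.card_sigma, ← Fintype.card_coe, ← Nat.card_eq_fintype_card]
  refine Nat.card_congr
    { toFun := fun e => ⟨⟨e.1.1.1, e.1.1.2⟩, ?_⟩
      invFun := fun s => ⟨⟨(s.1.1, s.1.2), ?_⟩, ?_⟩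
      left_inv := fun e => rfl
      right_inv := fun s => rfl }
  · have h1 : (cubeDegree N e.1.1.1 : ℤ) + i = i + j := e.2
    have h2 := e.1.2
    simp only [Finset.mem_sigma, Finset.mem_filter, Finset.mem_powersetCard]
    exact ⟨⟨h2.1.2, by omega⟩, h2.1.1, h2.2⟩
  · have := s.2
    simp only [Finset.mem_sigma, Finset.mem_filter, Finset.mem_powersetCard] at this
    exact ⟨⟨this.2.1, this.1.1⟩, this.2.2⟩
  · have := s.2
    simp only [Finset.mem_sigma, Finset.mem_filter, Finset.mem_powersetCard] at this
    change (cubeDegree N s.1.1 : ℤ) + i = i + j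
    omega

end CubicalResolution

/-! ### Vertex covers of whiskered graphs and independent sets. -/

section WhiskeredGraphs

variable {V : Type u} {r : ℕ} {Z : Type}

/-- The graph obtained from `G` by adding new vertices `w : Z`, where `w` is joined to all the
vertices of the block `W (p w)`. -/
def whiskeredGraph (G : SimpleGraph V) (W : Fin r → Finset V) (p : Z → Fin r) :
    SimpleGraph (V ⊕ Z) where
  Adj
    | .inl x, .inl y => G.Adj x y
    | .inl x, .inr w => x ∈ W (p w)
    | .inr w, .inl x => x ∈ W (p w)
    | .inr _, .inr _ => False
  symm := ⟨by
    rintro (x | i) (y | j) h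
    · exact G.adj_symm h
    · exact h
    · exact h
    · exact h⟩
  loopless := ⟨by
    rintro (x | i) h
    · exact G.loopless.irrefl x h
    · exact h⟩

theorem cliqueWhiskered_eq (G : SimpleGraph V) (W : Fin r → Finset V) :
    cliqueWhiskered G W = whiskeredGraph G W id := by
  ext (x | i) (y | j) <;> rfl

theorem multiCliqueWhiskered_eq (G : SimpleGraph V) (W : Fin r → Finset V) (n : Fin r → ℕ) :
    multiCliqueWhiskered G W n = whiskeredGraph G W Sigma.fst := by
  ext (x | i) (y | j) <;> rfl

theorem isVertexCover_whiskeredGraph {G : SimpleGraph V} {W : Fin r → Finset V} {p : Z → Fin r}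
    {C : Finset (V ⊕ Z)} : (whiskeredGraph G W p).IsVertexCover (C : Set (V ⊕ Z)) ↔
      (∀ x y, G.Adj x y → Sum.inl x ∈ C ∨ Sum.inl y ∈ C) ∧
      ∀ x w, x ∈ W (p w) → Sum.inl x ∈ C ∨ Sum.inr w ∈ C := by
  constructor
  · intro h
    exact ⟨fun x y hxy => h (v := Sum.inl x) (w := Sum.inl y) hxy,
      fun x w hxw => h (v := Sum.inl x) (w := Sum.inr w) hxw⟩
  · rintro ⟨h1, h2⟩ (x | w) (y | w') h
    · exact h1 x y h
    · exact h2 x w' h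
    · exact (h2 y w h).symm
    · exact h.elim

section

variable [Fintype Z]

/-- The new vertices that are joined to `x`. -/
noncomputable def newNeighbors (W : Fin r → Finset V) (p : Z → Fin r) (x : V) : Finset Z :=
  open Classical in {w | x ∈ W (p w)}

theorem mem_newNeighbors {W : Fin r → Finset V} {p : Z → Fin r} {x : V} {w : Z} :
    w ∈ newNeighbors W p x ↔ x ∈ W (p w) := by
  classical
  simp [newNeighbors]

end

variable [Fintype V]

/-- The independence complex of `G`. -/
noncomputable def independentFaces (G : SimpleGraph V) : Finset (Finset V) :=
  open Classical in {A | ∀ x ∈ A, ∀ y ∈ A, ¬ G.Adj x y}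

theorem mem_independentFaces {G : SimpleGraph V} {A : Finset V} :
    A ∈ independentFaces G ↔ ∀ x ∈ A, ∀ y ∈ A, ¬ G.Adj x y := by
  classical
  simp [independentFaces]

theorem mem_oldVerticesOutside {C : Finset (V ⊕ Z)} {x : V} :
    x ∈ oldVerticesOutside C ↔ Sum.inl x ∉ C := by
  classical
  simp [oldVerticesOutside]

theorem oldVerticesOutside_mem_independentFaces {G : SimpleGraph V} {W : Fin r → Finset V}
    {p : Z → Fin r} {C : Finset (V ⊕ Z)}
    (hC : (whiskeredGraph G W p).IsVertexCover (C : Set (V ⊕ Z))) :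
    oldVerticesOutside C ∈ independentFaces G := by
  rw [isVertexCover_whiskeredGraph] at hC
  rw [mem_independentFaces]
  intro x hx y hy hxy
  rw [mem_oldVerticesOutside] at hx hy
  exact (hC.1 x y hxy).elim hx hy

variable [Fintype Z]

/-- The vertex cover of the whiskered graph which belongs to an independent set `A`. -/
noncomputable def coverOutside (W : Fin r → Finset V) (p : Z → Fin r) (A : Finset V) :
    Finset (V ⊕ Z) :=
  open Classical in Aᶜ.disjSum (A.biUnion (newNeighbors W p))

theorem inl_mem_coverOutside {W : Fin r → Finset V} {p : Z → Fin r} {A : Finset V} {x : V} :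
    Sum.inl x ∈ coverOutside W p A ↔ x ∉ A := by
  simp [coverOutside]

theorem inr_mem_coverOutside {W : Fin r → Finset V} {p : Z → Fin r} {A : Finset V} {w : Z} :
    Sum.inr w ∈ coverOutside W p A ↔ ∃ x ∈ A, x ∈ W (p w) := by
  simp [coverOutside, mem_newNeighbors]

theorem oldVerticesOutside_coverOutside {W : Fin r → Finset V} {p : Z → Fin r} (A : Finset V) :
    oldVerticesOutside (coverOutside W p A) = A := by
  ext x
  rw [mem_oldVerticesOutside, inl_mem_coverOutside, not_not]

variable {G : SimpleGraph V} {W : Fin r → Finset V} {p : Z → Fin r}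

theorem isVertexCover_coverOutside {A : Finset V} (hA : A ∈ independentFaces G) :
    (whiskeredGraph G W p).IsVertexCover (coverOutside W p A : Set (V ⊕ Z)) := by
  rw [isVertexCover_whiskeredGraph]
  simp only [inl_mem_coverOutside, inr_mem_coverOutside]
  rw [mem_independentFaces] at hA
  refine ⟨fun x y hxy => ?_, fun x w hxw => ?_⟩
  · by_contra! h
    exact hA x h.1 y h.2 hxy
  · by_cases h : x ∈ A
    · exact Or.inr ⟨x, h, hxw⟩
    · exact Or.inl h

theorem coverOutside_subset {C : Finset (V ⊕ Z)}
    (hC : (whiskeredGraph G W p).IsVertexCover (C : Set (V ⊕ Z))) :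
    coverOutside W p (oldVerticesOutside C) ⊆ C := by
  rw [isVertexCover_whiskeredGraph] at hC
  rintro (x | w) h
  · rw [inl_mem_coverOutside, mem_oldVerticesOutside, not_not] at h
    exact h
  · rw [inr_mem_coverOutside] at h
    obtain ⟨x, hx, hxw⟩ := h
    exact (hC.2 x w hxw).resolve_left (mem_oldVerticesOutside.1 hx)

/-- Suppose `D` drops an old vertex `x ∉ A`. A whisker over the block of `x` must then lie in `D`,
so this block contains some `a ∈ A`; the edge from `x` to `a` is uncovered, since `a ∉ D`. A dropped
new vertex leaves its edge to `A` uncovered. -/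
theorem IsCliquePartition.coverOutside_subset_of_subset (hW : IsCliquePartition G W)
    (hp : Function.Surjective p) {A : Finset V} {D : Finset (V ⊕ Z)}
    (hD : (whiskeredGraph G W p).IsVertexCover (D : Set (V ⊕ Z)))
    (hDA : D ⊆ coverOutside W p A) : coverOutside W p A ⊆ D := by
  rw [isVertexCover_whiskeredGraph] at hD
  rintro (x | w) h
  · rw [inl_mem_coverOutside] at h
    obtain ⟨i, hi⟩ := hW.cover x
    obtain ⟨w, rfl⟩ := hp i
    rcases hD.2 x w hi with h1 | h1
    · exact h1
    · obtain ⟨a, haA, haw⟩ := inr_mem_coverOutside.1 (hDA h1)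
      have hxa : x ≠ a := by rintro rfl; exact h haA
      refine (hD.1 x a (hW.isClique _ hi haw hxa)).resolve_right fun h2 => ?_
      exact inl_mem_coverOutside.1 (hDA h2) haA
  · obtain ⟨a, haA, haw⟩ := inr_mem_coverOutside.1 h
    exact (hD.2 a w haw).resolve_left fun h2 => inl_mem_coverOutside.1 (hDA h2) haA

theorem mem_minVertexCovers {U : Type*} [Fintype U] {H : SimpleGraph U} {C : Finset U} :
    C ∈ minVertexCovers H ↔ Minimal (fun D : Finset U => H.IsVertexCover (D : Set U)) C := by
  classical
  simp [minVertexCovers]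

theorem IsCliquePartition.mem_minVertexCovers_iff (hW : IsCliquePartition G W)
    (hp : Function.Surjective p) {C : Finset (V ⊕ Z)} :
    C ∈ minVertexCovers (whiskeredGraph G W p) ↔
      ∃ A ∈ independentFaces G, coverOutside W p A = C := by
  rw [mem_minVertexCovers]
  constructor
  · intro hC
    have h1 := oldVerticesOutside_mem_independentFaces hC.prop
    exact ⟨_, h1, hC.eq_of_le (isVertexCover_coverOutside h1) (coverOutside_subset hC.prop)⟩
  · rintro ⟨A, hA, rfl⟩
    exact ⟨isVertexCover_coverOutside hA, fun D hD hDA =>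
      hW.coverOutside_subset_of_subset hp hD hDA⟩

open Classical in
theorem IsCliquePartition.minVertexCovers_eq (hW : IsCliquePartition G W)
    (hp : Function.Surjective p) :
    minVertexCovers (whiskeredGraph G W p) = (independentFaces G).image (coverOutside W p) := by
  ext C
  rw [hW.mem_minVertexCovers_iff hp, Finset.mem_image]

theorem coverOutside_injective : Function.Injective (coverOutside W p) :=
  Function.LeftInverse.injective oldVerticesOutside_coverOutside

/-- A common new neighbor would put two independent vertices into one clique. Thus the factors `Y x`
of `m_A` share no variable, and `m_A` is the squarefree monomial of a cover. -/
theorem IsCliquePartition.pairwiseDisjoint_newNeighbors (hW : IsCliquePartition G W)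
    {A : Finset V} (hA : A ∈ independentFaces G) :
    (A : Set V).PairwiseDisjoint (newNeighbors W p) := by
  intro x hx y hy hxy
  refine Finset.disjoint_left.2 fun w hwx hwy => ?_
  rw [mem_newNeighbors] at hwx hwy
  exact mem_independentFaces.1 hA x hx y hy (hW.isClique _ hwx hwy hxy)

theorem IsCliquePartition.card_coverOutside [DecidableEq V] (hW : IsCliquePartition G W)
    {A : Finset V} (hA : A ∈ independentFaces G) :
    #(coverOutside W p A) = cubeDegree (newNeighbors W p) A := by
  classical
  rw [coverOutside, Finset.card_disjSum, Finset.card_biUnion, cubeDegree]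
  · congr!
  · exact fun x hx y hy hxy => hW.pairwiseDisjoint_newNeighbors hA hx hy hxy

theorem IsCliquePartition.prod_coverOutside [DecidableEq V] (K : Type v) [Field K]
    (hW : IsCliquePartition G W) {A : Finset V} (hA : A ∈ independentFaces G) :
    ∏ x ∈ coverOutside W p A, (MvPolynomial.X x : MvPolynomial (V ⊕ Z) K) =
      cubeMonomial (oldVariable K Z) (newMonomial K (newNeighbors W p)) A := by
  classical
  rw [coverOutside, Finset.prod_disjSum, Finset.prod_biUnion, cubeMonomial]
  · congr!
  · exact hW.pairwiseDisjoint_newNeighbors hA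

/-- Any cover `C` contains `coverOutside` of its omitted old vertices, so its monomial is a multiple
of the corresponding `m_A`. -/
theorem IsCliquePartition.coverIdeal_eq [DecidableEq V] (K : Type v) [Field K]
    (hW : IsCliquePartition G W) : coverIdeal K (whiskeredGraph G W p) =
      Ideal.span (cubeMonomial (oldVariable K Z) (newMonomial K (newNeighbors W p)) ''
        (independentFaces G : Set (Finset V))) := by
  refine le_antisymm (Ideal.span_le.2 ?_) (Ideal.span_le.2 ?_)
  · rintro _ ⟨C, hC, rfl⟩
    have h1 := oldVerticesOutside_mem_independentFaces hC
    refine Ideal.mem_of_dvd _ (Finset.prod_dvd_prod_of_subset _ _ _ (coverOutside_subset hC)) ?_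
    rw [hW.prod_coverOutside K h1]
    exact Ideal.subset_span ⟨_, h1, rfl⟩
  · rintro _ ⟨A, hA, rfl⟩
    rw [← hW.prod_coverOutside K hA]
    exact Ideal.subset_span ⟨_, isVertexCover_coverOutside hA, rfl⟩

theorem independentFaces_downClosed (G : SimpleGraph V) :
    ∀ A ∈ independentFaces G, ∀ B ⊆ A, B ∈ independentFaces G := by
  intro A hA B hB
  rw [mem_independentFaces] at hA ⊢
  exact fun x hx y hy => hA x (hB hx) y (hB hy)

/-! ### Betti numbers and projective dimension of the cover ideal. -/

theorem IsCliquePartition.exists_minimal_resolution [DecidableEq V] (K : Type v) [Field K]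
    (hW : IsCliquePartition G W) (hp : Function.Surjective p) :
    ∃ F : GradedFreeResolution (coverIdeal K (whiskeredGraph G W p)), F.IsMinimal ∧
      ∀ (i : ℕ) (j : ℤ), F.rank i (i + j) =
        ∑ A ∈ independentFaces G with (cubeDegree (newNeighbors W p) A : ℤ) = j,
          (#A).choose i := by
  rw [hW.coverIdeal_eq K]
  have ho : Function.Injective fun x : V => (Fintype.equivFin V x : ℕ) :=
    Fin.val_injective.comp (Fintype.equivFin V).injective
  refine ⟨cubicalResolution K ho _ (independentFaces_downClosed G),
    cubicalResolution_isMinimal ho (fun x => ?_) _, fun i j => cubicalResolution_rank ho _ _ i j⟩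
  obtain ⟨i, hi⟩ := hW.cover x
  obtain ⟨w, rfl⟩ := hp i
  exact ⟨w, mem_newNeighbors.2 hi⟩

theorem IsCliquePartition.gradedBetti_coverIdeal (K : Type v) [Field K]
    (hW : IsCliquePartition G W) (hp : Function.Surjective p) (i : ℕ) (j : ℤ) :
    gradedBetti (coverIdeal K (whiskeredGraph G W p)) i (i + j) =
      ∑ C ∈ minVertexCovers (whiskeredGraph G W p) with (#C : ℤ) = j,
        (#(oldVerticesOutside C)).choose i := by
  classical
  obtain ⟨F, hF, hr⟩ := hW.exists_minimal_resolution K hp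
  rw [hF.gradedBetti_eq, hr, hW.minVertexCovers_eq hp, Finset.sum_filter, Finset.sum_filter,
    Finset.sum_image coverOutside_injective.injOn]
  refine Finset.sum_congr rfl fun A hA => ?_
  rw [hW.card_coverOutside hA, oldVerticesOutside_coverOutside]

theorem IsCliquePartition.gradedBetti_coverIdeal_ne_zero_iff (K : Type v) [Field K]
    (hW : IsCliquePartition G W) (hp : Function.Surjective p) (i : ℕ) (j : ℤ) :
    gradedBetti (coverIdeal K (whiskeredGraph G W p)) i j ≠ 0 ↔
      ∃ C ∈ minVertexCovers (whiskeredGraph G W p), (#C : ℤ) + i = j ∧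
        i ≤ #(oldVerticesOutside C) := by
  have := hW.gradedBetti_coverIdeal K hp i (j - i)
  rw [add_sub_cancel] at this
  rw [this, Ne, Finset.sum_eq_zero_iff]
  push Not
  simp only [Finset.mem_filter, Nat.choose_ne_zero_iff, and_assoc, eq_sub_iff_add_eq]

theorem IsCliquePartition.exists_isGreatest_projDim (K : Type v) [Field K]
    (hW : IsCliquePartition G W) (hp : Function.Surjective p) :
    IsGreatest {i | ∃ j : ℤ, gradedBetti (coverIdeal K (whiskeredGraph G W p)) i j ≠ 0}
      (projDim (coverIdeal K (whiskeredGraph G W p))) ∧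
    IsGreatest {k | ∃ C ∈ minVertexCovers (whiskeredGraph G W p), #(oldVerticesOutside C) = k}
      (projDim (coverIdeal K (whiskeredGraph G W p))) := by
  classical
  have hne : (minVertexCovers (whiskeredGraph G W p)).Nonempty := by
    exact ⟨_, (hW.mem_minVertexCovers_iff hp).2 ⟨∅, by simp [mem_independentFaces], rfl⟩⟩
  obtain ⟨C, hC, hmax⟩ := Finset.exists_max_image _ (fun C => #(oldVerticesOutside C)) hne
  have h : IsGreatest
      {i | ∃ j : ℤ, gradedBetti (coverIdeal K (whiskeredGraph G W p)) i j ≠ 0}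
      #(oldVerticesOutside C) := by
    -- The maximal `C` contributes the top binomial coefficient, and no larger homological degree
    -- gets a nonzero one.
    refine ⟨⟨_, (hW.gradedBetti_coverIdeal_ne_zero_iff K hp _ _).2 ⟨C, hC, rfl, le_rfl⟩⟩, ?_⟩
    rintro i ⟨j, hj⟩
    obtain ⟨D, hD, -, hi⟩ := (hW.gradedBetti_coverIdeal_ne_zero_iff K hp _ _).1 hj
    exact hi.trans (hmax D hD)
  have hpd : projDim (coverIdeal K (whiskeredGraph G W p)) = #(oldVerticesOutside C) := h.csSup_eq
  rw [hpd]
  refine ⟨h, ⟨C, hC, rfl⟩, ?_⟩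
  rintro _ ⟨D, hD, rfl⟩
  exact hmax D hD

theorem IsCliquePartition.bettiWellDefined_coverIdeal (K : Type v) [Field K]
    (hW : IsCliquePartition G W) (hp : Function.Surjective p) :
    BettiWellDefined (coverIdeal K (whiskeredGraph G W p)) := by
  classical
  obtain ⟨F, hF, -⟩ := hW.exists_minimal_resolution K hp
  exact ⟨⟨F, hF⟩, fun F' hF' i j => (hF'.gradedBetti_eq i j).symm,
    (hW.exists_isGreatest_projDim K hp).1⟩

theorem IsCliquePartition.gradedBetti_coverIdeal_eq (K : Type*) [Field K] (K' : Type*) [Field K']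
    (hW : IsCliquePartition G W) (hp : Function.Surjective p) (i : ℕ) (j : ℤ) :
    gradedBetti (coverIdeal K (whiskeredGraph G W p)) i j =
      gradedBetti (coverIdeal K' (whiskeredGraph G W p)) i j := by
  have h := hW.gradedBetti_coverIdeal K hp i (j - i)
  rw [← hW.gradedBetti_coverIdeal K' hp i (j - i), add_sub_cancel] at h
  exact h

/-- With one whisker per block, every old vertex has exactly one new neighbor, so exchanging `X x`
for `Y x` preserves the degree. This is the source of linearity. -/
theorem IsCliquePartition.card_of_mem_minVertexCovers (hW : IsCliquePartition G W)
    {C : Finset (V ⊕ Fin r)} (hC : C ∈ minVertexCovers (whiskeredGraph G W id)) :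
    #C = Fintype.card V := by
  classical
  obtain ⟨A, hA, rfl⟩ := (hW.mem_minVertexCovers_iff Function.surjective_id).1 hC
  have h1 : ∀ x, #(newNeighbors W id x) = 1 := fun x => by
    obtain ⟨i, hi⟩ := hW.cover x
    refine Finset.card_eq_one.2 ⟨i, Finset.eq_singleton_iff_unique_mem.2
      ⟨mem_newNeighbors.2 hi, fun k hk => ?_⟩⟩
    by_contra hki
    exact Finset.disjoint_left.1 (hW.disjoint hki) (mem_newNeighbors.1 hk) hi
  rw [hW.card_coverOutside hA, cubeDegree]
  simp [h1, Finset.card_compl_add_card]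

theorem IsCliquePartition.hasLinearResolution (K : Type v) [Field K]
    (hW : IsCliquePartition G W) :
    HasLinearResolution (coverIdeal K (whiskeredGraph G W id)) (Fintype.card V) := by
  intro i j hj
  obtain ⟨C, hC, h, -⟩ :=
    (hW.gradedBetti_coverIdeal_ne_zero_iff K Function.surjective_id i j).1 hj
  rw [← h, hW.card_of_mem_minVertexCovers hC, add_comm]

theorem IsCliquePartition.gradedBetti_eq_totalBetti (K : Type v) [Field K]
    (hW : IsCliquePartition G W) (i : ℕ) :
    gradedBetti (coverIdeal K (whiskeredGraph G W id)) i (i + Fintype.card V) =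
      totalBetti (coverIdeal K (whiskeredGraph G W id)) i := by
  rw [totalBetti, finsum_eq_single _ ((i : ℤ) + Fintype.card V)]
  intro j hj
  by_contra h
  exact hj (hW.hasLinearResolution K i j h)

theorem IsCliquePartition.totalBetti_eq (K : Type v) [Field K]
    (hW : IsCliquePartition G W) (i : ℕ) :
    totalBetti (coverIdeal K (whiskeredGraph G W id)) i =
      ∑ C ∈ minVertexCovers (whiskeredGraph G W id), (#(oldVerticesOutside C)).choose i := by
  rw [← hW.gradedBetti_eq_totalBetti K, hW.gradedBetti_coverIdeal K Function.surjective_id,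
    Finset.filter_true_of_mem]
  intro C hC
  rw [hW.card_of_mem_minVertexCovers hC]

end WhiskeredGraphs

theorem mainTheorem6 {V : Type*} [Fintype V] (G : SimpleGraph V) {r : ℕ} (W : Fin r → Finset V)
    (hW : IsCliquePartition G W) (K : Type*) [Field K] (K' : Type*) [Field K'] :
    -- Multi-clique-whiskered graphs.
    (∀ n : Fin r → ℕ, (∀ k, 0 < n k) →
      BettiWellDefined (coverIdeal K (multiCliqueWhiskered G W n)) ∧
      (∀ (i : ℕ) (j : ℤ),
        gradedBetti (coverIdeal K (multiCliqueWhiskered G W n)) i (i + j) =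
          ∑ C ∈ minVertexCovers (multiCliqueWhiskered G W n) with (#C : ℤ) = j,
            (#(oldVerticesOutside C)).choose i) ∧
      IsGreatest
        {k | ∃ C ∈ minVertexCovers (multiCliqueWhiskered G W n), #(oldVerticesOutside C) = k}
        (projDim (coverIdeal K (multiCliqueWhiskered G W n))) ∧
      (∀ (i : ℕ) (j : ℤ),
        gradedBetti (coverIdeal K (multiCliqueWhiskered G W n)) i j =
          gradedBetti (coverIdeal K' (multiCliqueWhiskered G W n)) i j)) ∧
    -- Clique-whiskered graphs.
    (BettiWellDefined (coverIdeal K (cliqueWhiskered G W)) ∧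
      HasLinearResolution (coverIdeal K (cliqueWhiskered G W)) (Fintype.card V) ∧
      (∀ i : ℕ,
        gradedBetti (coverIdeal K (cliqueWhiskered G W)) i (i + Fintype.card V) =
          totalBetti (coverIdeal K (cliqueWhiskered G W)) i) ∧
      (∀ i : ℕ,
        totalBetti (coverIdeal K (cliqueWhiskered G W)) i =
          ∑ C ∈ minVertexCovers (cliqueWhiskered G W), (#(oldVerticesOutside C)).choose i) ∧
      IsGreatest
        {k | ∃ C ∈ minVertexCovers (cliqueWhiskered G W), #(oldVerticesOutside C) = k}
        (projDim (coverIdeal K (cliqueWhiskered G W))) ∧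
      (∀ (i : ℕ) (j : ℤ),
        gradedBetti (coverIdeal K (cliqueWhiskered G W)) i j =
          gradedBetti (coverIdeal K' (cliqueWhiskered G W)) i j)) := by
  constructor
  · intro n hn
    -- Positivity of `n` says that every block has a whisker.
    have hp : Function.Surjective (Sigma.fst : (Σ i : Fin r, Fin (n i)) → Fin r) :=
      fun i => ⟨⟨i, ⟨0, hn i⟩⟩, rfl⟩
    rw [multiCliqueWhiskered_eq]
    exact ⟨hW.bettiWellDefined_coverIdeal K hp, hW.gradedBetti_coverIdeal K hp,
      (hW.exists_isGreatest_projDim K hp).2, hW.gradedBetti_coverIdeal_eq K K' hp⟩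
  · have hp : Function.Surjective (id : Fin r → Fin r) := Function.surjective_id
    rw [cliqueWhiskered_eq]
    exact ⟨hW.bettiWellDefined_coverIdeal K hp, hW.hasLinearResolution K,
      hW.gradedBetti_eq_totalBetti K, hW.totalBetti_eq K,
      (hW.exists_isGreatest_projDim K hp).2, hW.gradedBetti_coverIdeal_eq K K' hp⟩
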